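/- Let $\kappa(x,y,z)=x^2+y^2+z^2-xyz-2$ on $\mathbb R^3$, and let $\Gamma$ be the group of polynomial automorphisms $\gamma$ of $\mathbb R^3$ (bijections that are polynomial together with their inverse) which preserve $\kappa$, that is, $\kappa\circ\gamma=\kappa$. Let $\Omega_0=(-\infty,-2)^3$ and $\Omega=\Gamma\cdot\Omega_0=\bigcup_{\gamma\in\Gamma}\gamma(\Omega_0)$. For $t>2$ equip the smooth surface $\kappa^{-1}(t)\subset\mathbb R^3$ with the measure $\mu_t$ of the area form dual to the bivector field $$\Xi=\frac1{2\pi^2}\Big((2x-yz)\,\tfrac{\partial}{\partial y}\wedge\tfrac{\partial}{\partial z}+(2y-zx)\,\tfrac{\partial}{\partial z}\wedge\tfrac{\partial}{\partial x}+(2z-xy)\,\tfrac{\partial}{\partial x}\wedge\tfrac{\partial}{\partial y}\Big);$$ thus $d\mu_t=\dfrac{2\pi^2\,dx\,dy}{|2z-xy|}$ in the local coordinates $(x,y)$, off the $\mu_t$-null curve $2z=xy$. Then for every $t>2$ the action of $\Gamma$ on $\kappa^{-1}(t)-\Omega$ preserves the restriction of $\mu_t$ and is ergodic with respect to it: every measurable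 subset $A\subset\kappa^{-1}(t)-\Omega$ such that $\gamma^{-1}(A)$ and $A$ differ by a null set for every $\gamma\in\Gamma$ is either null or conull. -/

import Mathlib

open MeasureTheory

noncomputable section

namespace OneHoledTorus

/-- Real affine three-space, with coordinates `u 0 = x`, `u 1 = y`, `u 2 = z`. -/
abbrev R3 : Type := Fin 3 → ℝ

/-- The polynomial function `κ(x, y, z) = x² + y² + z² - x y z - 2`. -/
def kappa (u : R3) : ℝ :=
  u 0 ^ 2 + u 1 ^ 2 + u 2 ^ 2 - u 0 * u 1 * u 2 - 2

/-- Maps of `ℝ³` into itself whose three components are polynomials. -/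
def IsPolynomialMap (f : R3 → R3) : Prop :=
  ∃ P : Fin 3 → MvPolynomial (Fin 3) ℝ, ∀ u i, f u i = MvPolynomial.eval u (P i)

theorem IsPolynomialMap.comp {f g : R3 → R3} (hf : IsPolynomialMap f)
    (hg : IsPolynomialMap g) : IsPolynomialMap (f ∘ g) := by
  obtain ⟨P, hP⟩ := hf
  obtain ⟨Q, hQ⟩ := hg
  refine ⟨fun i => MvPolynomial.bind₁ Q (P i), fun u i => ?_⟩
  have hu : g u = fun j => MvPolynomial.eval u (Q j) := funext (hQ u)
  simp only [Function.comp_apply, hP, hu]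
  exact (MvPolynomial.eval₂Hom_bind₁ (RingHom.id ℝ) u Q (P i)).symm

theorem isPolynomialMap_id : IsPolynomialMap id :=
  ⟨MvPolynomial.X, fun u i => by simp⟩

/-- The group `Γ` of polynomial automorphisms that preserve `κ`: bijections which are polynomial
in both directions and leave `κ` invariant. -/
def Gam : Subgroup (Equiv.Perm R3) where
  carrier := {γ | IsPolynomialMap γ ∧ IsPolynomialMap γ.symm ∧ ∀ u, kappa (γ u) = kappa u}
  one_mem' := ⟨isPolynomialMap_id, isPolynomialMap_id, fun _ => rfl⟩
  mul_mem' := by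
    rintro a b ⟨ha, ha', hka⟩ ⟨hb, hb', hkb⟩
    exact ⟨ha.comp hb, hb'.comp ha', fun u => (hka (b u)).trans (hkb u)⟩
  inv_mem' := by
    rintro a ⟨ha, ha', hka⟩
    refine ⟨ha', ha, fun u => ?_⟩
    have h := hka (a.symm u)
    rw [Equiv.apply_symm_apply] at h
    exact h.symm

/-- The octant `Ω₀ = (-∞, -2)³`. -/
def Omega0 : Set R3 := {u | ∀ i, u i < -2}

/-- `Ω = Γ · Ω₀`, the union of all translates of the octant. -/
def Omega : Set R3 := {v | ∃ γ : Gam, ∃ u ∈ Omega0, γ • u = v}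

/-- The `Γ`-space `κ⁻¹(t) - Ω`, with the action of `Γ` restricted from `ℝ³`. -/
def levelComplement (t : ℝ) : SubMulAction Gam R3 where
  carrier := {u | kappa u = t ∧ u ∉ Omega}
  smul_mem' := by
    rintro γ u ⟨hu, hΩ⟩
    refine ⟨(γ.2.2.2 u).trans hu, ?_⟩
    rintro ⟨δ, v, hv, h⟩
    exact hΩ ⟨γ⁻¹ * δ, v, hv, by rw [mul_smul, h, inv_smul_smul]⟩

/-- The gradient of `κ`. -/
def gradKappa (u : R3) : R3 :=
  ![2 * u 0 - u 1 * u 2, 2 * u 1 - u 2 * u 0, 2 * u 2 - u 0 * u 1]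

/-- The bivector field `Ξ = (2π²)⁻¹ dκ · (∂x ∧ ∂y ∧ ∂z)`, that is
`(2π²)⁻¹ (κ_x ∂y ∧ ∂z + κ_y ∂z ∧ ∂x + κ_z ∂x ∧ ∂y)`, as an alternating form on pairs of
covectors `α`, `β` (given by their coefficients). -/
def poissonBivector (u α β : R3) : ℝ :=
  (2 * Real.pi ^ 2)⁻¹ * (gradKappa u ⬝ᵥ crossProduct α β)

/-- The discriminant of `κ(x, y, ·) = t`, a quadratic equation in the last coordinate. -/
def disc (t : ℝ) (p : ℝ × ℝ) : ℝ := (p.1 ^ 2 - 4) * (p.2 ^ 2 - 4) + 4 * (t - 2)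

/-- The upper (`s = 1`) and lower (`s = -1`) sheet of `κ⁻¹(t)` over the `(x, y)`-plane. -/
def sheet (t s : ℝ) (p : ℝ × ℝ) : R3 :=
  ![p.1, p.2, (p.1 * p.2 + s * √(disc t p)) / 2]

theorem kappa_sheet {t : ℝ} {p : ℝ × ℝ} (hp : 0 ≤ disc t p) {s : ℝ} (hs : s ^ 2 = 1) :
    kappa (sheet t s p) = t := by
  have h := Real.sq_sqrt hp
  have h2 : (s * √(disc t p)) ^ 2 = disc t p := by rw [mul_pow, hs, h, one_mul]
  simp only [kappa, sheet, Matrix.cons_val_zero, Matrix.cons_val_one, Matrix.cons_val]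
  have h3 : (s * √(disc t p)) ^ 2 = (p.1 ^ 2 - 4) * (p.2 ^ 2 - 4) + 4 * (t - 2) := h2
  nlinarith [h3]

/-- The part of `κ⁻¹(t)` where `κ_z ≠ 0` is the union of the two sheets over `disc > 0`. -/
theorem kappa_eq_and_iff_exists_sheet (t : ℝ) (u : R3) :
    (kappa u = t ∧ gradKappa u 2 ≠ 0) ↔
      ∃ s : ℝ, (s = 1 ∨ s = -1) ∧ ∃ p, 0 < disc t p ∧ sheet t s p = u := by
  constructor
  · rintro ⟨hk, hg⟩
    have hg' : 2 * u 2 - u 0 * u 1 ≠ 0 := hg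
    have hd : disc t (u 0, u 1) = (2 * u 2 - u 0 * u 1) ^ 2 := by
      rw [← hk]; simp only [disc, kappa]; ring
    have hpos : 0 < disc t (u 0, u 1) := by rw [hd]; positivity
    have hsq : √(disc t (u 0, u 1)) = |2 * u 2 - u 0 * u 1| := by rw [hd, Real.sqrt_sq_eq_abs]
    rcases lt_or_gt_of_ne hg' with h | h
    · refine ⟨-1, Or.inr rfl, (u 0, u 1), hpos, ?_⟩
      ext i
      fin_cases i <;> simp [sheet, hsq, abs_of_neg h]
    · refine ⟨1, Or.inl rfl, (u 0, u 1), hpos, ?_⟩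
      ext i
      fin_cases i <;> simp [sheet, hsq, abs_of_pos h]
  · rintro ⟨s, hs, p, hp, rfl⟩
    have hs2 : s ^ 2 = 1 := by rcases hs with rfl | rfl <;> norm_num
    refine ⟨kappa_sheet hp.le hs2, ?_⟩
    have hs0 : s ≠ 0 := by rcases hs with rfl | rfl <;> norm_num
    have : gradKappa (sheet t s p) 2 = s * √(disc t p) := by
      simp [gradKappa, sheet]; ring
    rw [this]
    exact mul_ne_zero hs0 (Real.sqrt_ne_zero'.mpr hp)

/-- The measure on `κ⁻¹(t)`, `t > 2`, of the area form dual to `Ξ`.  An area form `ω` on a surface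
is dual to a bivector `Ξ` when `ω(Ξ) = 1`, so in the local coordinates `(x, y)` the area form is
`dx ∧ dy / Ξ(dx, dy)`.  These coordinates are valid off the locus `κ_z = 0`, which for `t > 2` is a
smooth curve in the smooth surface `κ⁻¹(t)` and so a null set, and the rest of the surface is the
disjoint union of the two sheets over the region `disc > 0`. -/
def areaMeasure (t : ℝ) : Measure R3 :=
  ∑ s ∈ ({1, -1} : Finset ℝ),
    (((volume : Measure (ℝ × ℝ)).restrict {p | 0 < disc t p}).withDensity fun p =>
      ENNReal.ofReal |poissonBivector (sheet t s p) (Pi.single 0 1) (Pi.single 1 1)|⁻¹).map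
        (sheet t s)

/-- The area measure on the `Γ`-space `κ⁻¹(t) - Ω`. -/
def levelMeasure (t : ℝ) : Measure (levelComplement t) :=
  (areaMeasure t).comap Subtype.val

end OneHoledTorus

end

open Filter Topology

noncomputable section

namespace OneHoledTorus

/-! Invariance of the measure. The Jacobian determinant of a polynomial automorphism is a unit of
the polynomial ring, hence constant. An element of `Gam` fixes `0`, the only critical point of `κ`
at level `-2`, and its derivative there preserves the quadratic part of `κ + 2`, so the constant is
`±1` (`exists_jacobian_Gam`). A map preserving both volume and `κ` preserves the area form on level
sets; in the coordinates `(x, y)` this is `det_relation` followed by a change of variables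
(`areaMeasure_preimage`).

Ergodicity. For `|x| < 2` the curve `κ = t`, `x = const` is an ellipse, on which a Dehn twist acts
as a rotation by the angle `arccos (x / 2)`. For almost every `x` this is an irrational multiple of
`2π`, so by ergodicity of irrational rotations an invariant set meets almost every ellipse in a null
or conull set: inside the slab it is determined by `x` alone (`areaMeasure_slab_symmDiff`).
Exchanging `x` and `y`, it is also determined by `y` alone where `|x|, |y| < 2`, and Fubini makes it
null or conull in the slab (`slab_null_or_conull`).

The slab controls everything outside `Ω`. By trace reduction, replacing the largest of three traces
`> 2` by its Vieta conjugate lowers their sum by at least `√(4(t - 2))`, so finitely many moves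
bring a point outside `Ω` to `|x| ≤ 2` (`reachesSlab`). The moves are words in finitely many
generators, so only countably many null sets are discarded (`levelComplement_inter_null`). -/

/-! ### The Jacobian determinant of an element of `Γ` -/

theorem hasFDerivAt_eval (P : MvPolynomial (Fin 3) ℝ) (u : R3) :
    HasFDerivAt (fun v : R3 => MvPolynomial.eval v P)
      (∑ j, MvPolynomial.eval u (MvPolynomial.pderiv j P) •
        (ContinuousLinearMap.proj j : R3 →L[ℝ] ℝ)) u := by
  induction P using MvPolynomial.induction_on with
  | C a => simpa using hasFDerivAt_const a u
  | add p q hp hq =>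
    refine ((hp.add hq).congr_fderiv ?_).congr_of_eventuallyEq (.of_forall fun v => by simp)
    simp [add_smul, Finset.sum_add_distrib]
  | mul_X p i hp =>
    refine ((hp.mul (hasFDerivAt_apply i u)).congr_fderiv ?_).congr_of_eventuallyEq
      (.of_forall fun v => by simp)
    ext v
    fin_cases i <;> simp [Fin.sum_univ_three, MvPolynomial.pderiv_X] <;> ring

/-- The linear map of `ℝ³` with matrix `M`, as a continuous linear map. -/
def matCLM (M : Matrix (Fin 3) (Fin 3) ℝ) : R3 →L[ℝ] R3 :=
  LinearMap.toContinuousLinearMap (Matrix.toLin' M)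

@[simp] theorem matCLM_apply (M : Matrix (Fin 3) (Fin 3) ℝ) (v : R3) :
    matCLM M v = M.mulVec v := rfl

theorem matCLM_injective : Function.Injective matCLM := by
  intro M N h
  apply Matrix.toLin'.injective
  exact LinearMap.toContinuousLinearMap.injective h

theorem matCLM_comp (M N : Matrix (Fin 3) (Fin 3) ℝ) :
    (matCLM M).comp (matCLM N) = matCLM (M * N) := by
  ext v : 1
  simp [Matrix.mulVec_mulVec]

theorem matCLM_one : matCLM 1 = ContinuousLinearMap.id ℝ R3 := by
  ext v : 1
  simp

/-- The entries are kept as polynomials so that the determinant can be recognised as a unit of the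
polynomial ring. -/
theorem IsPolynomialMap.exists_jacobian {f : R3 → R3} (hf : IsPolynomialMap f) :
    ∃ J : Matrix (Fin 3) (Fin 3) (MvPolynomial (Fin 3) ℝ), ∀ u,
      HasFDerivAt f (matCLM (J.map (MvPolynomial.eval u))) u := by
  obtain ⟨P, hP⟩ := hf
  refine ⟨Matrix.of fun i j => MvPolynomial.pderiv j (P i), fun u => ?_⟩
  rw [hasFDerivAt_pi']
  intro i
  refine ((hasFDerivAt_eval (P i) u).congr_fderiv ?_).congr_of_eventuallyEq
    (.of_forall fun v => hP v i)
  ext v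
  simp [Matrix.mulVec, dotProduct]

theorem IsPolynomialMap.continuous {f : R3 → R3} (hf : IsPolynomialMap f) : Continuous f := by
  obtain ⟨J, hJ⟩ := hf.exists_jacobian
  exact continuous_iff_continuousAt.2 fun u => (hJ u).continuousAt

/-- The Jacobian determinant of a polynomial automorphism is constant. -/
theorem exists_jacobian_det_eq {γ : Equiv.Perm R3} (h : IsPolynomialMap γ)
    (h' : IsPolynomialMap γ.symm) :
    ∃ (J : R3 → Matrix (Fin 3) (Fin 3) ℝ) (c : ℝ), c ≠ 0 ∧
      (∀ u, HasFDerivAt γ (matCLM (J u)) u) ∧ ∀ u, (J u).det = c := by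
  obtain ⟨J, hJ⟩ := h.exists_jacobian
  obtain ⟨K, hK⟩ := h'.exists_jacobian
  obtain ⟨P, hP⟩ := h
  have hinv : ∀ u, (J.map (MvPolynomial.eval u)).det *
      (K.map (MvPolynomial.eval (γ u))).det = 1 := by
    intro u
    have h1 : HasFDerivAt (γ.symm ∘ γ) _ u := (hK (γ u)).comp u (hJ u)
    rw [Equiv.symm_comp_self, matCLM_comp] at h1
    have h2 := h1.unique (hasFDerivAt_id u)
    rw [← matCLM_one] at h2
    rw [mul_comm, ← Matrix.det_mul, matCLM_injective h2, Matrix.det_one]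
  -- Polynomials over the infinite field `ℝ` are determined by their values, so the pointwise
  -- identity `hinv` makes `J.det` a unit, that is, a nonzero constant.
  have hunit : J.det * MvPolynomial.bind₁ P K.det = 1 := by
    apply MvPolynomial.funext
    intro u
    have hu : γ u = fun j => MvPolynomial.eval u (P j) := funext (hP u)
    have e1 : MvPolynomial.eval u J.det = (J.map (MvPolynomial.eval u)).det :=
      RingHom.map_det _ _
    have e2 : MvPolynomial.eval u (MvPolynomial.bind₁ P K.det)
        = (K.map (MvPolynomial.eval (γ u))).det := by
      have e3 : MvPolynomial.eval (γ u) K.det = (K.map (MvPolynomial.eval (γ u))).det :=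
        RingHom.map_det _ _
      rw [← e3, hu]
      exact MvPolynomial.eval₂Hom_bind₁ (RingHom.id ℝ) u P K.det
    rw [map_mul, e1, e2, hinv u, map_one]
  obtain ⟨c, hc, hcJ⟩ := MvPolynomial.isUnit_iff_eq_C_of_isReduced.1 (IsUnit.of_mul_eq_one _ hunit)
  refine ⟨fun u => J.map (MvPolynomial.eval u), c, hc.ne_zero, hJ, fun u => ?_⟩
  have e1 : MvPolynomial.eval u J.det = (J.map (MvPolynomial.eval u)).det := RingHom.map_det _ _
  rw [← e1, hcJ, MvPolynomial.eval_C]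

theorem hasFDerivAt_kappa (u : R3) :
    HasFDerivAt kappa (∑ j, gradKappa u j • (ContinuousLinearMap.proj j : R3 →L[ℝ] ℝ)) u := by
  have h0 := hasFDerivAt_apply (𝕜 := ℝ) (0 : Fin 3) u
  have h1 := hasFDerivAt_apply (𝕜 := ℝ) (1 : Fin 3) u
  have h2 := hasFDerivAt_apply (𝕜 := ℝ) (2 : Fin 3) u
  refine ((((h0.pow 2).add (h1.pow 2)).add (h2.pow 2)).sub ((h0.mul h1).mul h2)
    |>.sub_const 2).congr_fderiv ?_
  ext v
  simp [Fin.sum_univ_three, gradKappa]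
  ring

theorem continuous_kappa : Continuous kappa :=
  continuous_iff_continuousAt.2 fun u => (hasFDerivAt_kappa u).continuousAt

/-- The chain rule for `κ ∘ γ = κ`. -/
theorem vecMul_gradKappa {γ : R3 → R3} (hγ : ∀ u, kappa (γ u) = kappa u) {u : R3}
    {M : Matrix (Fin 3) (Fin 3) ℝ} (hM : HasFDerivAt γ (matCLM M) u) :
    Matrix.vecMul (gradKappa (γ u)) M = gradKappa u := by
  have h1 : HasFDerivAt (kappa ∘ γ) _ u := (hasFDerivAt_kappa (γ u)).comp u hM
  rw [show kappa ∘ γ = kappa from funext hγ] at h1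
  have h2 := h1.unique (hasFDerivAt_kappa u)
  ext j
  have h3 := congrArg (fun L : R3 →L[ℝ] ℝ => L (Pi.single j 1)) h2
  simpa [Matrix.vecMul, dotProduct, Pi.single_apply, Matrix.col] using h3

/-- At a critical point `x² = y² = z² = xyz / 2`, so `κ = x² - 2` there. -/
theorem eq_zero_of_gradKappa_eq_zero {u : R3} (hu : gradKappa u = 0) (hk : kappa u = -2) :
    u = 0 := by
  have h0 : 2 * u 0 - u 1 * u 2 = 0 := congrFun hu 0
  have h1 : 2 * u 1 - u 2 * u 0 = 0 := congrFun hu 1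
  have h2 : 2 * u 2 - u 0 * u 1 = 0 := congrFun hu 2
  unfold kappa at hk
  have e0 : u 0 ^ 2 = 0 := by linear_combination hk - u 1 * h1 / 2 - u 2 * h2 / 2
  have e1 : u 1 ^ 2 = 0 := by linear_combination e0 - u 0 * h0 / 2 + u 1 * h1 / 2
  have e2 : u 2 ^ 2 = 0 := by linear_combination e0 - u 0 * h0 / 2 + u 2 * h2 / 2
  ext i
  fin_cases i
  · exact pow_eq_zero_iff two_ne_zero |>.1 e0
  · exact pow_eq_zero_iff two_ne_zero |>.1 e1
  · exact pow_eq_zero_iff two_ne_zero |>.1 e2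

/-- The derivative at a fixed point `0` of a map preserving `κ` is orthogonal. -/
theorem dotProduct_mulVec_self {γ : R3 → R3} (hγ : ∀ u, kappa (γ u) = kappa u) (h0 : γ 0 = 0)
    {M : Matrix (Fin 3) (Fin 3) ℝ} (hM : HasFDerivAt γ (matCLM M) 0) (v : R3) :
    M.mulVec v ⬝ᵥ M.mulVec v = v ⬝ᵥ v := by
  have hline : HasDerivAt (fun e : ℝ => γ (e • v)) (M.mulVec v) 0 := by
    have h1 : HasDerivAt (fun e : ℝ => e • v) v 0 := by
      simpa using (hasDerivAt_id (0 : ℝ)).smul_const v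
    have h2 : HasFDerivAt γ (matCLM M) ((0 : ℝ) • v) := by simpa using hM
    exact h2.comp_hasDerivAt 0 h1
  have hlim : Tendsto (fun e : ℝ => e⁻¹ • γ (e • v)) (𝓝[≠] 0) (𝓝 (M.mulVec v)) := by
    have := hasDerivAt_iff_tendsto_slope_zero.1 hline
    simpa [h0] using this
  have hc : ∀ i, Tendsto (fun e : ℝ => e⁻¹ * γ (e • v) i) (𝓝[≠] 0) (𝓝 (M.mulVec v i)) :=
    fun i => (tendsto_pi_nhds.1 hlim i)
  have he : Tendsto (fun e : ℝ => e) (𝓝[≠] 0) (𝓝 0) := tendsto_nhdsWithin_of_tendsto_nhds tendsto_id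
  -- `κ(γ(e v)) + 2 = κ(e v) + 2`, divided by `e²`: the cubic terms keep a factor `e`, so as `e → 0`
  -- only the quadratic forms survive.
  have hL := ((((hc 0).pow 2).add ((hc 1).pow 2)).add ((hc 2).pow 2)).sub
    (he.mul (((hc 0).mul (hc 1)).mul (hc 2)))
  have hR : Tendsto (fun e : ℝ => v 0 ^ 2 + v 1 ^ 2 + v 2 ^ 2 - e * (v 0 * v 1 * v 2)) (𝓝[≠] 0)
      (𝓝 (v 0 ^ 2 + v 1 ^ 2 + v 2 ^ 2 - 0 * (v 0 * v 1 * v 2))) :=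
    tendsto_const_nhds.sub (he.mul tendsto_const_nhds)
  have heq := tendsto_nhds_unique (hL.congr' ?_) hR
  · simp only [dotProduct, Fin.sum_univ_three]
    linear_combination heq
  · filter_upwards [self_mem_nhdsWithin] with e (hne : e ≠ 0)
    have hk := hγ (e • v)
    simp only [kappa, Pi.smul_apply, smul_eq_mul] at hk
    field_simp
    linear_combination hk

theorem det_sq_eq_one_of_dotProduct {M : Matrix (Fin 3) (Fin 3) ℝ}
    (h : ∀ v, M.mulVec v ⬝ᵥ M.mulVec v = v ⬝ᵥ v) : M.det ^ 2 = 1 := by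
  have hpol : ∀ v w, M.mulVec v ⬝ᵥ M.mulVec w = v ⬝ᵥ w := by
    intro v w
    have h1 := h (v + w)
    simp only [Matrix.mulVec_add, add_dotProduct, dotProduct_add, h v, h w] at h1
    rw [dotProduct_comm (M.mulVec w), dotProduct_comm w v] at h1
    linarith
  have hM : M.transpose * M = 1 := by
    ext i j
    have := hpol (Pi.single i 1) (Pi.single j 1)
    rw [Matrix.mulVec_single_one, Matrix.mulVec_single_one] at this
    rw [Matrix.mul_apply, Matrix.one_apply]
    simpa [dotProduct, Pi.single_apply, Matrix.col, eq_comm] using this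
  have := congrArg Matrix.det hM
  rw [Matrix.det_mul, Matrix.det_transpose, Matrix.det_one] at this
  rw [sq, this]

/-- Elements of `Γ` preserve volume. -/
theorem exists_jacobian_Gam (γ : Gam) :
    ∃ (J : R3 → Matrix (Fin 3) (Fin 3) ℝ) (c : ℝ), c ^ 2 = 1 ∧
      (∀ u, HasFDerivAt (γ : Equiv.Perm R3) (matCLM (J u)) u) ∧ ∀ u, (J u).det = c := by
  obtain ⟨γ, h, h', hk⟩ := γ
  obtain ⟨J, c, hc, hJ, hdet⟩ := exists_jacobian_det_eq h h'
  refine ⟨J, c, ?_, hJ, hdet⟩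
  have h0 : γ 0 = 0 := by
    apply eq_zero_of_gradKappa_eq_zero
    · apply Matrix.eq_zero_of_vecMul_eq_zero (M := J 0) (by rwa [hdet])
      rw [vecMul_gradKappa hk (hJ 0)]
      ext i
      fin_cases i <;> simp [gradKappa]
    · rw [hk]; simp [kappa]
  rw [← hdet 0]
  exact det_sq_eq_one_of_dotProduct (dotProduct_mulVec_self hk h0 (hJ 0))

/-! ### The two sheets -/

/-- The region of the `(x, y)`-plane over which `κ⁻¹(t)` has two sheets. -/
def base (t : ℝ) : Set (ℝ × ℝ) := {p | 0 < disc t p}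

/-- The image of `base t` under `sheet t s`. -/
def sheetRegion (t s : ℝ) : Set R3 := {u | kappa u = t ∧ 0 < s * gradKappa u 2}

/-- The density of the area measure in the coordinates `(x, y)`. -/
def density (t : ℝ) (p : ℝ × ℝ) : ENNReal := ENNReal.ofReal (2 * Real.pi ^ 2 / √(disc t p))

theorem continuous_disc (t : ℝ) : Continuous (disc t) := by
  unfold disc; fun_prop

theorem isOpen_base (t : ℝ) : IsOpen (base t) :=
  isOpen_lt continuous_const (continuous_disc t)

theorem measurableSet_base (t : ℝ) : MeasurableSet (base t) := (isOpen_base t).measurableSet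

theorem continuous_sheet (t s : ℝ) : Continuous (sheet t s) := by
  have := continuous_disc t
  refine continuous_pi fun i => ?_
  fin_cases i <;> simp [sheet] <;> fun_prop

theorem continuous_gradKappa : Continuous gradKappa := by
  refine continuous_pi fun i => ?_
  fin_cases i <;> simp [gradKappa] <;> fun_prop

theorem measurableSet_sheetRegion (t s : ℝ) : MeasurableSet (sheetRegion t s) := by
  have h : Continuous fun u : R3 => s * gradKappa u 2 :=
    continuous_const.mul ((continuous_apply 2).comp continuous_gradKappa)
  exact (measurableSet_eq_fun continuous_kappa.measurable measurable_const).inter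
    (measurableSet_lt measurable_const h.measurable)

theorem measurable_density (t : ℝ) : Measurable (density t) := by
  have := (continuous_disc t).measurable
  unfold density
  fun_prop

theorem gradKappa_sheet (t s : ℝ) (p : ℝ × ℝ) :
    gradKappa (sheet t s p) 2 = s * √(disc t p) := by
  simp [gradKappa, sheet]; ring

theorem sheet_mem_sheetRegion {t s : ℝ} (hs : s ^ 2 = 1) {p : ℝ × ℝ} (hp : p ∈ base t) :
    sheet t s p ∈ sheetRegion t s := by
  refine ⟨kappa_sheet (le_of_lt hp) hs, ?_⟩
  rw [gradKappa_sheet, ← mul_assoc, ← sq, hs, one_mul]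
  exact Real.sqrt_pos.2 hp

/-- The discriminant of a monic quadratic is the square of its derivative at a root. -/
theorem disc_eq_gradKappa_sq {t : ℝ} {u : R3} (hu : kappa u = t) :
    disc t (u 0, u 1) = gradKappa u 2 ^ 2 := by
  rw [← hu]; simp [disc, kappa, gradKappa]; ring

theorem mem_base_of_mem_sheetRegion {t s : ℝ} {u : R3} (hu : u ∈ sheetRegion t s) :
    (u 0, u 1) ∈ base t := by
  have h : gradKappa u 2 ≠ 0 := fun h => by simpa [h] using hu.2
  show 0 < disc t (u 0, u 1)
  rw [disc_eq_gradKappa_sq hu.1]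
  positivity

theorem sheet_proj {t s : ℝ} (hs : s ^ 2 = 1) {u : R3} (hu : u ∈ sheetRegion t s) :
    sheet t s (u 0, u 1) = u := by
  have h : s * √(disc t (u 0, u 1)) = gradKappa u 2 := by
    rw [disc_eq_gradKappa_sq hu.1,
      show gradKappa u 2 ^ 2 = (s * gradKappa u 2) ^ 2 by rw [mul_pow, hs, one_mul],
      Real.sqrt_sq hu.2.le, ← mul_assoc, ← sq, hs, one_mul]
  ext i
  fin_cases i
  · rfl
  · rfl
  · show (u 0 * u 1 + s * √(disc t (u 0, u 1))) / 2 = u 2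
    rw [h]; simp [gradKappa]

theorem sheetRegion_disjoint (t : ℝ) : Disjoint (sheetRegion t 1) (sheetRegion t (-1)) := by
  rw [Set.disjoint_left]
  rintro u ⟨-, h⟩ ⟨-, h'⟩
  linarith

theorem mem_sheetRegion_or {t : ℝ} {u : R3} (hu : kappa u = t) (hg : gradKappa u 2 ≠ 0) :
    u ∈ sheetRegion t 1 ∨ u ∈ sheetRegion t (-1) := by
  rcases lt_or_gt_of_ne hg with h | h
  · exact Or.inr ⟨hu, by linarith⟩
  · exact Or.inl ⟨hu, by linarith⟩

theorem poissonBivector_sheet {t s : ℝ} (hs : s ^ 2 = 1) (p : ℝ × ℝ) :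
    |poissonBivector (sheet t s p) (Pi.single 0 1) (Pi.single 1 1)|⁻¹ =
      2 * Real.pi ^ 2 / √(disc t p) := by
  have h1 : gradKappa (sheet t s p) ⬝ᵥ
      crossProduct (Pi.single 0 1 : R3) (Pi.single 1 1) = s * √(disc t p) := by
    rw [← gradKappa_sheet]
    simp [cross_apply, dotProduct, Fin.sum_univ_three]
  have h2 : |s| = 1 := by rw [← sq_eq_sq₀ (abs_nonneg s) zero_le_one, sq_abs, hs, one_pow]
  rw [poissonBivector, h1, abs_mul, abs_mul, h2, one_mul, abs_of_nonneg (Real.sqrt_nonneg _),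
    abs_of_nonneg (by positivity), mul_inv, inv_inv, div_eq_mul_inv]

theorem areaMeasure_apply (t : ℝ) {S : Set R3} (hS : MeasurableSet S) :
    areaMeasure t S = (∫⁻ p in base t ∩ sheet t 1 ⁻¹' S, density t p) +
      ∫⁻ p in base t ∩ sheet t (-1) ⁻¹' S, density t p := by
  have key : ∀ s : ℝ, s ^ 2 = 1 →
      ((((volume : Measure (ℝ × ℝ)).restrict {p | 0 < disc t p}).withDensity fun p =>
        ENNReal.ofReal |poissonBivector (sheet t s p) (Pi.single 0 1) (Pi.single 1 1)|⁻¹).map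
          (sheet t s)) S = ∫⁻ p in base t ∩ sheet t s ⁻¹' S, density t p := by
    intro s hs
    have hm := (continuous_sheet t s).measurable
    rw [Measure.map_apply hm hS, withDensity_apply _ (hm hS),
      Measure.restrict_restrict (hm hS), Set.inter_comm]
    simp only [poissonBivector_sheet hs]
    rfl
  unfold areaMeasure
  rw [Finset.sum_pair (by norm_num), Measure.add_apply, key 1 (by norm_num), key (-1) (by norm_num)]

/-- The sign of `κ_z` separates the sheets, so only one of the two integrals survives. -/
theorem areaMeasure_sheetRegion_inter {t s : ℝ} (hs : s = 1 ∨ s = -1) {S : Set R3}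
    (hS : MeasurableSet S) :
    areaMeasure t (sheetRegion t s ∩ S) = ∫⁻ p in base t ∩ sheet t s ⁻¹' S, density t p := by
  have h1 : ∀ s : ℝ, s ^ 2 = 1 →
      base t ∩ sheet t s ⁻¹' (sheetRegion t s ∩ S) = base t ∩ sheet t s ⁻¹' S := by
    intro s hs
    ext p
    exact ⟨fun h => ⟨h.1, h.2.2⟩, fun h => ⟨h.1, sheet_mem_sheetRegion hs h.1, h.2⟩⟩
  have h2 : ∀ s : ℝ, s ^ 2 = 1 →
      base t ∩ sheet t (-s) ⁻¹' (sheetRegion t s ∩ S) = ∅ := by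
    intro s hs
    ext p
    refine ⟨fun h => ?_, False.elim⟩
    have h3 := (sheet_mem_sheetRegion (s := -s) (by rwa [neg_sq]) h.1).2
    have h4 := h.2.1.2
    simp only [gradKappa_sheet] at h3 h4
    linarith
  rw [areaMeasure_apply t ((measurableSet_sheetRegion t s).inter hS)]
  rcases hs with rfl | rfl
  · rw [h1 1 (by norm_num), h2 1 (by norm_num)]; simp
  · have := h2 (-1) (by norm_num)
    rw [neg_neg] at this
    rw [h1 (-1) (by norm_num), this]; simp

theorem areaMeasure_compl_sheetRegions (t : ℝ) :
    areaMeasure t (sheetRegion t 1 ∪ sheetRegion t (-1))ᶜ = 0 := by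
  rw [areaMeasure_apply t
    ((measurableSet_sheetRegion t 1).union (measurableSet_sheetRegion t (-1))).compl]
  have h : ∀ s : ℝ, s = 1 ∨ s = -1 →
      base t ∩ sheet t s ⁻¹' (sheetRegion t 1 ∪ sheetRegion t (-1))ᶜ = ∅ := by
    intro s hs
    ext p
    refine ⟨fun h => h.2 ?_, False.elim⟩
    rcases hs with rfl | rfl
    · exact Or.inl (sheet_mem_sheetRegion (by norm_num) h.1)
    · exact Or.inr (sheet_mem_sheetRegion (by norm_num) h.1)
  rw [h 1 (Or.inl rfl), h (-1) (Or.inr rfl)]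
  simp

theorem density_ne_zero {t : ℝ} {p : ℝ × ℝ} (hp : p ∈ base t) : density t p ≠ 0 := by
  have : 0 < √(disc t p) := Real.sqrt_pos.2 hp
  exact (ENNReal.ofReal_pos.2 (by positivity)).ne'

theorem setLIntegral_density_eq_zero_iff {t : ℝ} {E : Set (ℝ × ℝ)} (hE : MeasurableSet E) :
    ∫⁻ p in base t ∩ E, density t p = 0 ↔ volume (base t ∩ E) = 0 := by
  rw [setLIntegral_eq_zero_iff ((measurableSet_base t).inter hE) (measurable_density t)]
  rw [measure_eq_zero_iff_ae_notMem]
  refine ⟨fun h => ?_, fun h => ?_⟩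
  · filter_upwards [h] with p hp hpE using density_ne_zero hpE.1 (hp hpE)
  · filter_upwards [h] with p hp hpE using absurd hpE hp

theorem areaMeasure_eq_zero_iff {t : ℝ} {S : Set R3} (hS : MeasurableSet S) :
    areaMeasure t S = 0 ↔ volume (base t ∩ sheet t 1 ⁻¹' S) = 0 ∧
      volume (base t ∩ sheet t (-1) ⁻¹' S) = 0 := by
  rw [areaMeasure_apply t hS, add_eq_zero,
    setLIntegral_density_eq_zero_iff ((continuous_sheet t 1).measurable hS),
    setLIntegral_density_eq_zero_iff ((continuous_sheet t (-1)).measurable hS)]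

/-! ### Invariance of the area measure -/

theorem det_prodCLM (L : ℝ × ℝ →L[ℝ] ℝ × ℝ) :
    L.det = (L (1, 0)).1 * (L (0, 1)).2 - (L (0, 1)).1 * (L (1, 0)).2 := by
  rw [ContinuousLinearMap.det, ← LinearMap.det_toMatrix (Module.Basis.finTwoProd ℝ),
    Matrix.det_fin_two]
  simp [LinearMap.toMatrix_apply]

/-- The projection to the `(x, y)`-plane. -/
def projCLM : R3 →L[ℝ] ℝ × ℝ :=
  (ContinuousLinearMap.proj 0).prod (ContinuousLinearMap.proj 1)

@[simp] theorem projCLM_apply (u : R3) : projCLM u = (u 0, u 1) := rfl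

/-- Tangency to the level set comes from differentiating `κ ∘ sheet = t`; with the two trivial
components it is all that is needed, and the square root is never differentiated explicitly. -/
theorem exists_hasFDerivAt_sheet {t s : ℝ} (hs : s ^ 2 = 1) {p : ℝ × ℝ} (hp : p ∈ base t) :
    ∃ L : ℝ × ℝ →L[ℝ] R3, HasFDerivAt (sheet t s) L p ∧ (∀ w, L w 0 = w.1) ∧
      (∀ w, L w 1 = w.2) ∧ ∀ w, gradKappa (sheet t s p) ⬝ᵥ L w = 0 := by
  have hd : DifferentiableAt ℝ (sheet t s) p := by
    have h1 : DifferentiableAt ℝ (disc t) p := by unfold disc; fun_prop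
    have h2 : DifferentiableAt ℝ (fun q => √(disc t q)) p := h1.sqrt (ne_of_gt hp)
    rw [differentiableAt_pi]
    intro i
    fin_cases i <;> simp [sheet] <;> fun_prop
  refine ⟨fderiv ℝ (sheet t s) p, hd.hasFDerivAt, fun w => ?_, fun w => ?_, fun w => ?_⟩
  · have h1 := (hasFDerivAt_pi'.1 hd.hasFDerivAt) 0
    have h2 : HasFDerivAt (fun q : ℝ × ℝ => sheet t s q 0) (ContinuousLinearMap.fst ℝ ℝ ℝ) p :=
      hasFDerivAt_fst
    exact congrArg (fun L : ℝ × ℝ →L[ℝ] ℝ => L w) (h1.unique h2)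
  · have h1 := (hasFDerivAt_pi'.1 hd.hasFDerivAt) 1
    have h2 : HasFDerivAt (fun q : ℝ × ℝ => sheet t s q 1) (ContinuousLinearMap.snd ℝ ℝ ℝ) p :=
      hasFDerivAt_snd
    exact congrArg (fun L : ℝ × ℝ →L[ℝ] ℝ => L w) (h1.unique h2)
  · have h1 : HasFDerivAt (kappa ∘ sheet t s) _ p :=
      (hasFDerivAt_kappa (sheet t s p)).comp p hd.hasFDerivAt
    have h2 : HasFDerivAt (kappa ∘ sheet t s) (0 : ℝ × ℝ →L[ℝ] ℝ) p := by
      refine (hasFDerivAt_const t p).congr_of_eventuallyEq ?_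
      filter_upwards [(isOpen_base t).mem_nhds hp] with q hq using kappa_sheet (le_of_lt hq) hs
    have := congrArg (fun L : ℝ × ℝ →L[ℝ] ℝ => L w) (h1.unique h2)
    simpa [dotProduct] using this

/-- Since `v` and `w` are orthogonal to `g`, `g₂ (v × w) = g`. The cofactor matrix of `M` sends `v ×
w` to `Mv × Mw` and, as `G M = g`, sends `g` to `det M · G`; the last component is the claim. As a
polynomial identity it requires neither `det M ≠ 0` nor `g₂ ≠ 0`. -/
theorem det_relation {M : Matrix (Fin 3) (Fin 3) ℝ} {g G v w : R3} (hG : Matrix.vecMul G M = g)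
    (hv0 : v 0 = 1) (hv1 : v 1 = 0) (hw0 : w 0 = 0) (hw1 : w 1 = 1)
    (hv : g ⬝ᵥ v = 0) (hw : g ⬝ᵥ w = 0) :
    (M.mulVec v 0 * M.mulVec w 1 - M.mulVec w 0 * M.mulVec v 1) * g 2 = M.det * G 2 := by
  have h0 := congrFun hG 0
  have h1 := congrFun hG 1
  have h2 := congrFun hG 2
  simp only [Matrix.vecMul, Matrix.mulVec, dotProduct, Fin.sum_univ_three, hv0, hv1, hw0, hw1,
    Matrix.det_fin_three] at *
  linear_combination (M 0 2 * M 1 1 - M 0 1 * M 1 2) * hv +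
    (M 0 0 * M 1 2 - M 0 2 * M 1 0) * hw - (M 0 0 * M 1 1 - M 0 1 * M 1 0) * h2 -
    (M 0 2 * M 1 0 - M 0 0 * M 1 2) * h1 - (M 0 1 * M 1 2 - M 0 2 * M 1 1) * h0

theorem Gam_kappa (γ : Gam) (u : R3) : kappa (γ • u) = kappa u := γ.2.2.2 u

theorem Gam_continuous (γ : Gam) : Continuous fun u : R3 => γ • u :=
  IsPolynomialMap.continuous γ.2.1

theorem Gam_measurable (γ : Gam) : Measurable fun u : R3 => γ • u :=
  (Gam_continuous γ).measurable

/-- The expression in the coordinates `(x, y)` of an element of `Γ` restricted to a sheet has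
Jacobian determinant equal to the ratio of the densities. -/
theorem exists_hasFDerivAt_chart (γ : Gam) {t s s' : ℝ} (hs : s ^ 2 = 1)
    {p : ℝ × ℝ} (hp : p ∈ base t) (hγp : γ • sheet t s p ∈ sheetRegion t s') :
    ∃ L : ℝ × ℝ →L[ℝ] ℝ × ℝ, HasFDerivAt (fun p => projCLM (γ • sheet t s p)) L p ∧
      density t p = ENNReal.ofReal |L.det| * density t (projCLM (γ • sheet t s p)) := by
  obtain ⟨J, c, hc, hJ, hdet⟩ := exists_jacobian_Gam γ
  obtain ⟨L, hL, hL0, hL1, hLg⟩ := exists_hasFDerivAt_sheet hs hp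
  set u := sheet t s p with hu
  refine ⟨projCLM.comp ((matCLM (J u)).comp L),
    projCLM.hasFDerivAt.comp p ((hJ u).comp p hL), ?_⟩
  have hrel := det_relation (vecMul_gradKappa γ.2.2.2 (hJ u)) (v := L (1, 0)) (w := L (0, 1))
    (hL0 _) (hL1 _) (hL0 _) (hL1 _) (hLg _) (hLg _)
  rw [hdet] at hrel
  have hdetL : (projCLM.comp ((matCLM (J u)).comp L)).det = (J u).mulVec (L (1, 0)) 0 *
      (J u).mulVec (L (0, 1)) 1 - (J u).mulVec (L (0, 1)) 0 * (J u).mulVec (L (1, 0)) 1 := by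
    rw [det_prodCLM]; simp
  rw [← hdetL] at hrel
  have hab : ∀ a : ℝ, a ^ 2 = 1 → |a| = 1 := fun a ha => by
    rw [← sq_eq_sq₀ (abs_nonneg a) zero_le_one, sq_abs, ha, one_pow]
  have hsq := congrArg abs hrel
  have hg : |gradKappa u 2| = √(disc t p) := by
    rw [hu, gradKappa_sheet, abs_mul, hab s hs, one_mul, abs_of_nonneg (Real.sqrt_nonneg _)]
  have hG : |gradKappa ((γ : Equiv.Perm R3) u) 2| = √(disc t (projCLM (γ • u))) := by
    rw [projCLM_apply, disc_eq_gradKappa_sq hγp.1, Real.sqrt_sq_eq_abs]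
    rfl
  rw [abs_mul, abs_mul, hg, hG, hab c hc, one_mul] at hsq
  have h1 : 0 < √(disc t p) := Real.sqrt_pos.2 hp
  have h2 : 0 < √(disc t (projCLM (γ • u))) :=
    Real.sqrt_pos.2 (mem_base_of_mem_sheetRegion hγp)
  rw [density, density, ← ENNReal.ofReal_mul (abs_nonneg _), ← hsq]
  congr 1
  have h3 : |(projCLM.comp ((matCLM (J u)).comp L)).det| ≠ 0 := by
    intro h0
    rw [h0, zero_mul] at hsq
    exact h2.ne hsq
  field_simp

/-- Change of variables: the Jacobian factor is the ratio of the densities. An inequality is enough,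
because equality will follow by using it for `γ⁻¹` too. The condition involving `γ⁻¹` on the right
keeps the contributions of the two source sheets disjoint, so that they can be added. -/
theorem areaMeasure_inter_preimage_le (γ : Gam) {t s s' : ℝ} (hs : s = 1 ∨ s = -1)
    (hs' : s' = 1 ∨ s' = -1) {S : Set R3} (hS : MeasurableSet S) :
    areaMeasure t (sheetRegion t s ∩ (γ • ·) ⁻¹' (sheetRegion t s' ∩ S)) ≤
      areaMeasure t (sheetRegion t s' ∩ ((γ⁻¹ • ·) ⁻¹' sheetRegion t s ∩ S)) := by
  have hs2 : s ^ 2 = 1 := by rcases hs with rfl | rfl <;> norm_num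
  have hs2' : s' ^ 2 = 1 := by rcases hs' with rfl | rfl <;> norm_num
  have hm : MeasurableSet ((γ • ·) ⁻¹' (sheetRegion t s' ∩ S)) :=
    Gam_measurable γ ((measurableSet_sheetRegion t s').inter hS)
  rw [areaMeasure_sheetRegion_inter hs hm, areaMeasure_sheetRegion_inter hs'
    ((Gam_measurable γ⁻¹ (measurableSet_sheetRegion t s)).inter hS)]
  set E := base t ∩ sheet t s ⁻¹' ((γ • ·) ⁻¹' (sheetRegion t s' ∩ S)) with hE
  have hEm : MeasurableSet E := (measurableSet_base t).inter ((continuous_sheet t s).measurable hm)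
  have hchart : ∀ p ∈ E, ∃ L : ℝ × ℝ →L[ℝ] ℝ × ℝ,
      HasFDerivAt (fun p => projCLM (γ • sheet t s p)) L p ∧
      density t p = ENNReal.ofReal |L.det| * density t (projCLM (γ • sheet t s p)) :=
    fun p hp => exists_hasFDerivAt_chart γ hs2 hp.1 hp.2.1
  choose! L hL hdens using hchart
  have hback : ∀ p ∈ E, sheet t s' (projCLM (γ • sheet t s p)) = γ • sheet t s p :=
    fun p hp => sheet_proj hs2' hp.2.1
  have hinj : Set.InjOn (fun p => projCLM (γ • sheet t s p)) E := by
    intro p hp q hq (hpq : projCLM (γ • sheet t s p) = projCLM (γ • sheet t s q))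
    have h1 := congrArg (sheet t s') hpq
    rw [hback p hp, hback q hq] at h1
    have h2 := smul_left_cancel γ h1
    exact congrArg projCLM h2
  rw [setLIntegral_congr_fun hEm hdens, ← lintegral_image_eq_lintegral_abs_det_fderiv_mul volume hEm
    (fun p hp => (hL p hp).hasFDerivWithinAt) hinj (density t)]
  apply lintegral_mono_set
  rintro _ ⟨p, hp, rfl⟩
  refine ⟨mem_base_of_mem_sheetRegion hp.2.1, ?_⟩
  show sheet t s' (projCLM (γ • sheet t s p)) ∈ (γ⁻¹ • ·) ⁻¹' sheetRegion t s ∩ S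
  rw [hback p hp]
  refine ⟨?_, hp.2.2⟩
  show γ⁻¹ • (γ • sheet t s p) ∈ sheetRegion t s
  rw [inv_smul_smul]
  exact sheet_mem_sheetRegion hs2 hp.1

/-! ### Permutations of the coordinates -/

theorem kappa_comp_perm (e : Equiv.Perm (Fin 3)) (u : R3) : kappa (u ∘ e) = kappa u := by
  have h : ∀ v : R3, kappa v = ∑ i, v i ^ 2 - ∏ i, v i - 2 := fun v => by
    simp [kappa, Fin.sum_univ_three, Fin.prod_univ_three]
  rw [h, h]
  simp only [Function.comp_apply]
  rw [Equiv.sum_comp e (fun i => u i ^ 2), Equiv.prod_comp e u]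

/-- The element of `Γ` permuting the coordinates. -/
def permGam (e : Equiv.Perm (Fin 3)) : Gam :=
  ⟨⟨fun u => u ∘ e, fun u => u ∘ e.symm, fun u => by ext; simp, fun u => by ext; simp⟩,
    ⟨fun i => MvPolynomial.X (e i), fun u i => by simp⟩,
    ⟨fun i => MvPolynomial.X (e.symm i), fun u i => by simp⟩, kappa_comp_perm e⟩

theorem permGam_smul (e : Equiv.Perm (Fin 3)) (u : R3) : permGam e • u = u ∘ e := rfl

theorem volume_eq_zero_of_slices_finite {B : Set (ℝ × ℝ)} (hB : MeasurableSet B)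
    (h : ∀ x, (Prod.mk x ⁻¹' B).Finite) : volume B = 0 := by
  rw [Measure.volume_eq_prod]
  exact Measure.measure_prod_null_of_ae_null hB (.of_forall fun x => (h x).measure_zero _)

/-- The curve `κ_y = 0` is null. -/
theorem areaMeasure_gradKappa_one_eq_zero (t : ℝ) :
    areaMeasure t {u | gradKappa u 1 = 0} = 0 := by
  have hm : MeasurableSet {u : R3 | gradKappa u 1 = 0} :=
    measurableSet_eq_fun ((continuous_apply 1).comp continuous_gradKappa).measurable
      measurable_const
  have key : ∀ s : ℝ, s ^ 2 = 1 →
      volume (base t ∩ sheet t s ⁻¹' {u | gradKappa u 1 = 0}) = 0 := by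
    intro s hs
    apply volume_eq_zero_of_slices_finite
      ((measurableSet_base t).inter ((continuous_sheet t s).measurable hm))
    intro x
    -- Squaring `κ_y = 0` gives `y² (x² - 4)² = disc · x²`. For `x = ±2` this contradicts `disc >
    -- 0`; otherwise it determines `y²`.
    by_cases hx : x ^ 2 - 4 = 0
    · convert Set.finite_empty
      ext y
      refine ⟨fun h => ?_, False.elim⟩
      have h1 : 0 < disc t (x, y) := h.1
      have h2 : 2 * y - (x * y + s * √(disc t (x, y))) / 2 * x = 0 := h.2
      have h3 : s * √(disc t (x, y)) * x = 0 := by linear_combination -2 * h2 - y * hx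
      have h4 : (s * √(disc t (x, y)) * x) ^ 2 = disc t (x, y) * x ^ 2 := by
        rw [mul_pow, mul_pow, hs, Real.sq_sqrt h1.le, one_mul]
      rw [h3] at h4
      nlinarith
    · refine (Set.toFinite {√(x ^ 2 * (x ^ 2 - 2 - t) / (x ^ 2 - 4)),
        -√(x ^ 2 * (x ^ 2 - 2 - t) / (x ^ 2 - 4))}).subset fun y hy => ?_
      have h1 : 0 < disc t (x, y) := hy.1
      have h2 : 2 * y - (x * y + s * √(disc t (x, y))) / 2 * x = 0 := hy.2
      have h3 : s * √(disc t (x, y)) * x = -(y * (x ^ 2 - 4)) := by linear_combination -2 * h2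
      have h4 : (s * √(disc t (x, y)) * x) ^ 2 = disc t (x, y) * x ^ 2 := by
        rw [mul_pow, mul_pow, hs, Real.sq_sqrt h1.le, one_mul]
      rw [h3] at h4
      simp only [disc] at h4
      have h5 : x ^ 2 * (x ^ 2 - 2 - t) / (x ^ 2 - 4) = y ^ 2 := by
        field_simp
        linear_combination h4 / 4
      rw [h5, Real.sqrt_sq_eq_abs]
      rcases abs_choice y with h | h <;> rw [h] <;> simp
  rw [areaMeasure_eq_zero_iff hm]
  exact ⟨key 1 (by norm_num), key (-1) (by norm_num)⟩

/-- At a critical point all three squares equal `t + 2`, and `4x² = y²z²` then forces `t + 2` to be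
`0` or `4`. -/
theorem gradKappa_ne_zero {t : ℝ} (ht : 2 < t) {u : R3} (hu : kappa u = t)
    (h1 : gradKappa u 1 = 0) (h2 : gradKappa u 2 = 0) : gradKappa u 0 ≠ 0 := by
  intro h0
  replace h0 : 2 * u 0 - u 1 * u 2 = 0 := h0
  replace h1 : 2 * u 1 - u 2 * u 0 = 0 := h1
  replace h2 : 2 * u 2 - u 0 * u 1 = 0 := h2
  unfold kappa at hu
  have e0 : u 0 ^ 2 = t + 2 := by linear_combination hu - u 1 * h1 / 2 - u 2 * h2 / 2
  have e1 : u 1 ^ 2 = t + 2 := by linear_combination e0 - u 0 * h0 / 2 + u 1 * h1 / 2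
  have e2 : u 2 ^ 2 = t + 2 := by linear_combination e0 - u 0 * h0 / 2 + u 2 * h2 / 2
  have e3 : 4 * u 0 ^ 2 = u 1 ^ 2 * u 2 ^ 2 := by
    linear_combination (2 * u 0 + u 1 * u 2) * h0
  rw [e0, e1, e2] at e3
  nlinarith

/-! ### Gluing the sheets: invariance under all of `Γ` -/

theorem sheetRegion_inter_preimage_null (γ : Gam) {t : ℝ} {S : Set R3} (hS : MeasurableSet S)
    (h0 : areaMeasure t S = 0) {s s' : ℝ} (hs : s = 1 ∨ s = -1) (hs' : s' = 1 ∨ s' = -1) :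
    areaMeasure t (sheetRegion t s ∩ (γ • ·) ⁻¹' (sheetRegion t s' ∩ S)) = 0 :=
  le_zero_iff.1 <| (areaMeasure_inter_preimage_le γ hs hs' hS).trans
    ((measure_mono fun _ h => h.2.2).trans h0.le)

/-- `Γ` does not move a set of positive measure into the locus where `(x, y)` fail to be
coordinates. -/
theorem areaMeasure_preimage_compl_sheetRegions (γ : Gam) {t : ℝ} (ht : 2 < t) :
    areaMeasure t ((γ • ·) ⁻¹' (sheetRegion t 1 ∪ sheetRegion t (-1))ᶜ) = 0 := by
  have hm : MeasurableSet {u : R3 | gradKappa u 1 = 0} :=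
    measurableSet_eq_fun ((continuous_apply 1).comp continuous_gradKappa).measurable
      measurable_const
  -- Where `κ_z` vanishes at `γ • u`, another partial derivative does not. The swap (if it is `κ_y`)
  -- or the rotation (if it is `κ_x`) moves it to the third place and the vanishing one to the
  -- second, where the null curve `κ_y = 0` applies.
  let e : Fin 2 → Equiv.Perm (Fin 3) := ![Equiv.swap 1 2, finRotate 3]
  have key : ∀ (k : Fin 2) (s s' : ℝ), (s = 1 ∨ s = -1) → (s' = 1 ∨ s' = -1) →
      areaMeasure t (sheetRegion t s ∩
        ((permGam (e k) * γ) • ·) ⁻¹' (sheetRegion t s' ∩ {u | gradKappa u 1 = 0})) = 0 :=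
    fun k s s' hs hs' => sheetRegion_inter_preimage_null _ hm
      (areaMeasure_gradKappa_one_eq_zero t) hs hs'
  have hp : (1 : ℝ) = 1 ∨ (1 : ℝ) = -1 := Or.inl rfl
  have hn : (-1 : ℝ) = 1 ∨ (-1 : ℝ) = -1 := Or.inr rfl
  refine measure_mono_null (t := (sheetRegion t 1 ∪ sheetRegion t (-1))ᶜ ∪
    ⋃ k : Fin 2, ((sheetRegion t 1 ∩ ((permGam (e k) * γ) • ·) ⁻¹' (sheetRegion t 1 ∩
      {u | gradKappa u 1 = 0})) ∪ (sheetRegion t 1 ∩ ((permGam (e k) * γ) • ·) ⁻¹'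
      (sheetRegion t (-1) ∩ {u | gradKappa u 1 = 0}))) ∪ ((sheetRegion t (-1) ∩
      ((permGam (e k) * γ) • ·) ⁻¹' (sheetRegion t 1 ∩ {u | gradKappa u 1 = 0})) ∪
      (sheetRegion t (-1) ∩ ((permGam (e k) * γ) • ·) ⁻¹' (sheetRegion t (-1) ∩
      {u | gradKappa u 1 = 0})))) ?_ ?_
  · intro u hu
    by_cases hW : u ∈ sheetRegion t 1 ∪ sheetRegion t (-1)
    swap
    · exact Or.inl hW
    right
    have hk : kappa (γ • u) = t := by
      rw [Gam_kappa]
      rcases hW with h | h <;> exact h.1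
    have h2 : gradKappa (γ • u) 2 = 0 := by
      by_contra h2
      exact hu (mem_sheetRegion_or hk h2)
    have hex : ∃ k : Fin 2, gradKappa ((permGam (e k) * γ) • u) 2 ≠ 0 ∧
        gradKappa ((permGam (e k) * γ) • u) 1 = 0 := by
      by_cases h1 : gradKappa (γ • u) 1 = 0
      · refine ⟨1, ?_⟩
        have h0 := gradKappa_ne_zero ht hk h1 h2
        rw [mul_smul, permGam_smul]
        constructor
        · show 2 * (γ • u) 0 - (γ • u) 1 * (γ • u) 2 ≠ 0
          exact h0
        · rw [← h2]; rfl
      · refine ⟨0, ?_⟩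
        rw [mul_smul, permGam_smul]
        constructor
        · show 2 * (γ • u) 1 - (γ • u) 0 * (γ • u) 2 ≠ 0
          rw [mul_comm ((γ • u) 0)]
          exact h1
        · show 2 * (γ • u) 2 - (γ • u) 1 * (γ • u) 0 = 0
          rw [mul_comm ((γ • u) 1)]
          exact h2
    obtain ⟨k, hk2, hk1⟩ := hex
    rw [Set.mem_iUnion]
    refine ⟨k, ?_⟩
    have hk' : kappa ((permGam (e k) * γ) • u) = t := by rw [mul_smul, Gam_kappa, hk]
    rcases hW with h | h <;> rcases mem_sheetRegion_or hk' hk2 with h' | h'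
    · exact Or.inl (Or.inl ⟨h, h', hk1⟩)
    · exact Or.inl (Or.inr ⟨h, h', hk1⟩)
    · exact Or.inr (Or.inl ⟨h, h', hk1⟩)
    · exact Or.inr (Or.inr ⟨h, h', hk1⟩)
  · refine measure_union_null (areaMeasure_compl_sheetRegions t) (measure_iUnion_null fun k => ?_)
    exact measure_union_null (measure_union_null (key k _ _ hp hp) (key k _ _ hp hn))
      (measure_union_null (key k _ _ hn hp) (key k _ _ hn hn))

theorem measure_inter_add_inter_le {α : Type*} [MeasurableSpace α] (μ : Measure α) {V V' X : Set α}
    (hV' : MeasurableSet V') (hX : MeasurableSet X) (h : Disjoint V V') :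
    μ (V ∩ X) + μ (V' ∩ X) ≤ μ X := by
  rw [← measure_union (h.mono Set.inter_subset_left Set.inter_subset_left) (hV'.inter hX)]
  exact measure_mono (Set.union_subset Set.inter_subset_right Set.inter_subset_right)

/-- The set is cut according to the sheets containing `u` and `γ • u`, up to null sets; for each
target sheet the two source sheets contribute disjoint pieces. -/
theorem areaMeasure_preimage_le (γ : Gam) {t : ℝ} (ht : 2 < t) {S : Set R3}
    (hS : MeasurableSet S) : areaMeasure t ((γ • ·) ⁻¹' S) ≤ areaMeasure t S := by
  set W := sheetRegion t with hW
  have hWm := measurableSet_sheetRegion t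
  set V : ℝ → Set R3 := fun s => (γ⁻¹ • ·) ⁻¹' W s with hV
  have hVm : ∀ s, MeasurableSet (V s) := fun s => Gam_measurable γ⁻¹ (hWm s)
  have hp : (1 : ℝ) = 1 ∨ (1 : ℝ) = -1 := Or.inl rfl
  have hn : (-1 : ℝ) = 1 ∨ (-1 : ℝ) = -1 := Or.inr rfl
  have hle : areaMeasure t ((γ • ·) ⁻¹' S) ≤
      (areaMeasure t (W 1 ∩ (γ • ·) ⁻¹' (W 1 ∩ S)) + areaMeasure t (W (-1) ∩ (γ • ·) ⁻¹' (W 1 ∩ S)))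
      + (areaMeasure t (W 1 ∩ (γ • ·) ⁻¹' (W (-1) ∩ S)) +
        areaMeasure t (W (-1) ∩ (γ • ·) ⁻¹' (W (-1) ∩ S))) := by
    have h0 : areaMeasure t ((W 1 ∪ W (-1))ᶜ ∪ (γ • ·) ⁻¹' (W 1 ∪ W (-1))ᶜ) = 0 :=
      measure_union_null (areaMeasure_compl_sheetRegions t)
        (areaMeasure_preimage_compl_sheetRegions γ ht)
    calc _ ≤ areaMeasure t (((W 1 ∪ W (-1))ᶜ ∪ (γ • ·) ⁻¹' (W 1 ∪ W (-1))ᶜ) ∪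
          (((W 1 ∩ (γ • ·) ⁻¹' (W 1 ∩ S)) ∪ (W (-1) ∩ (γ • ·) ⁻¹' (W 1 ∩ S))) ∪
          ((W 1 ∩ (γ • ·) ⁻¹' (W (-1) ∩ S)) ∪ (W (-1) ∩ (γ • ·) ⁻¹' (W (-1) ∩ S))))) := by
          refine measure_mono fun u hu => ?_
          simp only [Set.mem_union, Set.mem_inter_iff, Set.mem_compl_iff, Set.mem_preimage] at hu ⊢
          tauto
      _ ≤ _ := by
          refine (measure_union_le _ _).trans ?_
          rw [h0, zero_add]
          exact (measure_union_le _ _).trans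
            (add_le_add (measure_union_le _ _) (measure_union_le _ _))
  have hdis : Disjoint (V 1) (V (-1)) := (sheetRegion_disjoint t).preimage _
  have hsum : ∀ s', s' = 1 ∨ s' = -1 →
      areaMeasure t (W 1 ∩ (γ • ·) ⁻¹' (W s' ∩ S)) +
        areaMeasure t (W (-1) ∩ (γ • ·) ⁻¹' (W s' ∩ S)) ≤ areaMeasure t (W s' ∩ S) := by
    intro s' hs'
    refine (add_le_add (areaMeasure_inter_preimage_le γ hp hs' hS)
      (areaMeasure_inter_preimage_le γ hn hs' hS)).trans ?_
    rw [Set.inter_left_comm, Set.inter_left_comm (W s')]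
    exact measure_inter_add_inter_le _ (hVm _) ((hWm s').inter hS) hdis
  exact hle.trans ((add_le_add (hsum 1 hp) (hsum (-1) hn)).trans
    (measure_inter_add_inter_le _ (hWm _) hS (sheetRegion_disjoint t)))

theorem areaMeasure_preimage (γ : Gam) {t : ℝ} (ht : 2 < t) {S : Set R3}
    (hS : MeasurableSet S) : areaMeasure t ((γ • ·) ⁻¹' S) = areaMeasure t S := by
  refine (areaMeasure_preimage_le γ ht hS).antisymm ?_
  have h := areaMeasure_preimage_le γ⁻¹ ht (Gam_measurable γ hS)
  rwa [← Set.preimage_comp, show ((γ • ·) ∘ (γ⁻¹ • ·) : R3 → R3) = id from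
    funext fun u => smul_inv_smul γ u, Set.preimage_id] at h

theorem areaMeasure_preimage_eq_zero (γ : Gam) {t : ℝ} (ht : 2 < t) {S : Set R3}
    (hS : areaMeasure t S = 0) : areaMeasure t ((γ • ·) ⁻¹' S) = 0 := by
  obtain ⟨S', hSS', hS'm, hS'0⟩ := exists_measurable_superset_of_null hS
  exact measure_mono_null (Set.preimage_mono hSS') ((areaMeasure_preimage γ ht hS'm).trans hS'0)

instance fact_two_pi_pos : Fact (0 < 2 * Real.pi) := ⟨Real.two_pi_pos⟩

/-! ### The elliptic part of the level set -/

/-- The amplitude of the coordinates `y`, `z` on the ellipse `κ = t`, `x = const`. -/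
def radius (t x : ℝ) : ℝ := √(4 * (t - 2) / (4 - x ^ 2) + 4)

/-- The parametrization of the ellipse `κ = t`, `x = const` for `-2 < x < 2`. -/
def fibre (t x φ : ℝ) : R3 :=
  ![x, radius t x * Real.cos φ, radius t x * Real.cos (φ + Real.arccos (x / 2))]

/-- The cosine on the circle. -/
def circleCos (a : AddCircle (2 * Real.pi)) : ℝ := Real.Angle.cos a

theorem continuous_circleCos : Continuous circleCos := Real.Angle.continuous_cos

theorem circleCos_coe (φ : ℝ) : circleCos (φ : AddCircle (2 * Real.pi)) = Real.cos φ :=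
  Real.Angle.cos_coe φ

/-- The parametrization `fibre`, as a map from the circle. -/
def circleFibre (t : ℝ) (q : ℝ × AddCircle (2 * Real.pi)) : R3 :=
  ![q.1, radius t q.1 * circleCos q.2,
    radius t q.1 * circleCos (q.2 + (Real.arccos (q.1 / 2) : ℝ))]

theorem circleFibre_coe (t x φ : ℝ) :
    circleFibre t (x, (φ : AddCircle (2 * Real.pi))) = fibre t x φ := by
  simp only [circleFibre, fibre, ← AddCircle.coe_add, circleCos_coe]

theorem measurable_circleFibre (t : ℝ) : Measurable (circleFibre t) := by
  have hr : Measurable (radius t) := by unfold radius; fun_prop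
  have hc := continuous_circleCos.measurable
  have ha : Measurable fun q : ℝ × AddCircle (2 * Real.pi) =>
      ((Real.arccos (q.1 / 2) : ℝ) : AddCircle (2 * Real.pi)) :=
    (AddCircle.continuous_mk' (2 * Real.pi)).measurable.comp
      (Real.continuous_arccos.measurable.comp (measurable_fst.div_const 2))
  refine measurable_pi_iff.2 fun i => ?_
  fin_cases i
  · exact measurable_fst
  · exact (hr.comp measurable_fst).mul (hc.comp measurable_snd)
  · exact (hr.comp measurable_fst).mul (hc.comp (measurable_snd.add ha))

theorem radius_sq {t x : ℝ} (ht : 2 < t) (hx : |x| < 2) :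
    (4 - x ^ 2) * radius t x ^ 2 = 4 * (t - 2) + 4 * (4 - x ^ 2) := by
  have h4 : 0 < 4 - x ^ 2 := by nlinarith [abs_lt.1 hx]
  rw [radius, Real.sq_sqrt (by have : 0 < t - 2 := by linarith
                               positivity)]
  field_simp

theorem radius_pos {t x : ℝ} (ht : 2 < t) (hx : |x| < 2) : 0 < radius t x := by
  have h4 : 0 < 4 - x ^ 2 := by nlinarith [abs_lt.1 hx]
  have : 0 < t - 2 := by linarith
  exact Real.sqrt_pos.2 (by positivity)

theorem disc_eq_radius {t x : ℝ} (ht : 2 < t) (hx : |x| < 2) (y : ℝ) :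
    disc t (x, y) = (4 - x ^ 2) * (radius t x ^ 2 - y ^ 2) := by
  simp only [disc]
  linear_combination -radius_sq ht hx

theorem disc_pos_iff {t x : ℝ} (ht : 2 < t) (hx : |x| < 2) (y : ℝ) :
    0 < disc t (x, y) ↔ |y| < radius t x := by
  have h4 : 0 < 4 - x ^ 2 := by nlinarith [abs_lt.1 hx]
  rw [disc_eq_radius ht hx, mul_pos_iff_of_pos_left h4, sub_pos, sq_lt_sq,
    abs_of_pos (radius_pos ht hx)]

/-- The lower sheet is the half `sin φ ≥ 0` of the ellipse, the upper sheet the other one. -/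
theorem sheet_eq_fibre {t s x φ : ℝ} (ht : 2 < t) (hx : |x| < 2)
    (hs : s * |Real.sin φ| = - Real.sin φ) :
    sheet t s (x, radius t x * Real.cos φ) = fibre t x φ := by
  have hr := radius_pos ht hx
  have h4 : 0 < 4 - x ^ 2 := by nlinarith [abs_lt.1 hx]
  have hx' := abs_lt.1 hx
  have hsq : √(disc t (x, radius t x * Real.cos φ)) =
      √(4 - x ^ 2) * (radius t x * |Real.sin φ|) := by
    rw [disc_eq_radius ht hx, Real.sqrt_mul h4.le,
      show radius t x ^ 2 - (radius t x * Real.cos φ) ^ 2 = (radius t x * Real.sin φ) ^ 2 by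
        rw [mul_pow, mul_pow, Real.sin_sq]; ring, Real.sqrt_sq_eq_abs, abs_mul, abs_of_pos hr]
  have hsin : Real.sin (Real.arccos (x / 2)) = √(4 - x ^ 2) / 2 := by
    rw [Real.sin_arccos, show 1 - (x / 2) ^ 2 = (4 - x ^ 2) / 2 ^ 2 by ring,
      Real.sqrt_div h4.le, Real.sqrt_sq (by norm_num)]
  have hcos : Real.cos (Real.arccos (x / 2)) = x / 2 :=
    Real.cos_arccos (by linarith) (by linarith)
  ext i
  fin_cases i
  · rfl
  · rfl
  · show (x * (radius t x * Real.cos φ) + s * √(disc t (x, radius t x * Real.cos φ))) / 2 =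
      radius t x * Real.cos (φ + Real.arccos (x / 2))
    rw [hsq, Real.cos_add, hsin, hcos]
    linear_combination (√(4 - x ^ 2) * radius t x / 2) * hs

theorem volume_circle_eq_zero_iff {B : Set (AddCircle (2 * Real.pi))} (hB : MeasurableSet B) :
    volume B = 0 ↔
      volume {φ : ℝ | φ ∈ Set.Ioc (-Real.pi) Real.pi ∧ (φ : AddCircle (2 * Real.pi)) ∈ B} = 0 := by
  have h := (AddCircle.measurePreserving_mk (2 * Real.pi) (-Real.pi)).measure_preimage
    hB.nullMeasurableSet
  rw [← h, Measure.restrict_apply (hB.preimage (AddCircle.measurable_mk' (a := 2 * Real.pi))),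
    show -Real.pi + 2 * Real.pi = Real.pi by ring, Set.inter_comm]
  rfl

/-- Null sets of the ellipse, in the angle and in the coordinate `y`. -/
theorem volume_fibre_eq_zero_iff {t x : ℝ} (ht : 2 < t) (hx : |x| < 2) {S : Set R3}
    (hS : MeasurableSet S) :
    volume {a : AddCircle (2 * Real.pi) | circleFibre t (x, a) ∈ S} = 0 ↔
      volume {y | 0 < disc t (x, y) ∧ sheet t 1 (x, y) ∈ S} = 0 ∧
      volume {y | 0 < disc t (x, y) ∧ sheet t (-1) (x, y) ∈ S} = 0 := by
  have hr := radius_pos ht hx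
  have hpi := Real.pi_pos
  have hB : MeasurableSet {a : AddCircle (2 * Real.pi) | circleFibre t (x, a) ∈ S} :=
    ((measurable_circleFibre t).comp measurable_prodMk_left) hS
  rw [volume_circle_eq_zero_iff hB]
  simp only [Set.mem_ofPred_eq, circleFibre_coe]
  have hcosarc : ∀ y, 0 < disc t (x, y) →
      radius t x * Real.cos (Real.arccos (y / radius t x)) = y ∧
      0 < Real.arccos (y / radius t x) ∧ Real.arccos (y / radius t x) < Real.pi := by
    intro y hy
    have h1 := abs_lt.1 ((disc_pos_iff ht hx y).1 hy)
    have h2 : -1 < y / radius t x := by rw [lt_div_iff₀ hr]; linarith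
    have h3 : y / radius t x < 1 := by rw [div_lt_one hr]; linarith
    refine ⟨?_, Real.arccos_pos.2 h3, Real.arccos_lt_pi.2 h2⟩
    rw [Real.cos_arccos h2.le h3.le]
    field_simp
  constructor
  · intro h
    -- Differentiable maps send null sets to null sets. Over `y`, the upper sheet is the angle
    -- `-arccos (y / r)` and the lower sheet is `arccos (y / r)`.
    have himg := addHaar_image_eq_zero_of_differentiableOn_of_addHaar_eq_zero volume
      (f := fun φ : ℝ => radius t x * Real.cos φ)
      (Differentiable.differentiableOn (by fun_prop)) h
    constructor
    · refine measure_mono_null (fun y hy => ?_) himg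
      obtain ⟨h1, h2, h3⟩ := hcosarc y hy.1
      refine ⟨-Real.arccos (y / radius t x), ⟨⟨by linarith, by linarith⟩, ?_⟩, ?_⟩
      · rw [← sheet_eq_fibre (s := 1) ht hx, Real.cos_neg, h1]
        · exact hy.2
        · rw [Real.sin_neg, abs_neg, abs_of_pos (Real.sin_pos_of_pos_of_lt_pi h2 h3)]; ring
      · simp only [Real.cos_neg, h1]
    · refine measure_mono_null (fun y hy => ?_) himg
      obtain ⟨h1, h2, h3⟩ := hcosarc y hy.1
      refine ⟨Real.arccos (y / radius t x), ⟨⟨by linarith, by linarith⟩, ?_⟩, h1⟩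
      rw [← sheet_eq_fibre (s := -1) ht hx, h1]
      · exact hy.2
      · rw [abs_of_pos (Real.sin_pos_of_pos_of_lt_pi h2 h3)]; ring
  · rintro ⟨hp, hn⟩
    -- `arccos` fails to be differentiable at `±1`, but `disc > 0` means `|y| < r`; the angles `0`
    -- and `π` left out are a null set.
    have hdiff : ∀ s : ℝ, DifferentiableOn ℝ (fun y => Real.arccos (y / radius t x))
        {y | 0 < disc t (x, y) ∧ sheet t s (x, y) ∈ S} := by
      intro s y hy
      have h1 := abs_lt.1 ((disc_pos_iff ht hx y).1 hy.1)
      have h2 : -1 < y / radius t x := by rw [lt_div_iff₀ hr]; linarith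
      have h3 : y / radius t x < 1 := by rw [div_lt_one hr]; linarith
      have h4 : DifferentiableAt ℝ Real.arccos (y / radius t x) :=
        Real.differentiableAt_arccos.2 ⟨h2.ne', h3.ne⟩
      have h5 : DifferentiableAt ℝ (fun y => y / radius t x) y := by fun_prop
      exact (DifferentiableAt.comp (g := Real.arccos) y h4 h5).differentiableWithinAt
    have ip := addHaar_image_eq_zero_of_differentiableOn_of_addHaar_eq_zero volume (hdiff 1).neg hp
    have im := addHaar_image_eq_zero_of_differentiableOn_of_addHaar_eq_zero volume (hdiff (-1)) hn
    have h0 : volume ({0, Real.pi} : Set ℝ) = 0 := (Set.toFinite _).measure_zero _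
    refine measure_mono_null ?_ (measure_union_null h0 (measure_union_null ip im))
    rintro φ ⟨⟨hφ1, hφ2⟩, hφS⟩
    rcases eq_or_ne φ 0 with rfl | hne
    · exact Or.inl (Or.inl rfl)
    rcases eq_or_lt_of_le hφ2 with rfl | hlt
    · exact Or.inl (Or.inr rfl)
    right
    have hsin : Real.sin φ ≠ 0 := by
      intro h
      rw [Real.sin_eq_zero_iff_of_lt_of_lt hφ1 hlt] at h
      exact hne h
    have hdisc : 0 < disc t (x, radius t x * Real.cos φ) := by
      rw [disc_pos_iff ht hx, abs_mul, abs_of_pos hr]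
      have : |Real.cos φ| < 1 := by
        rw [← sq_lt_one_iff_abs_lt_one]
        have := Real.sin_sq_add_cos_sq φ
        have : 0 < Real.sin φ ^ 2 := by positivity
        nlinarith
      nlinarith
    have hdiv : radius t x * Real.cos φ / radius t x = Real.cos φ := by field_simp
    rcases lt_or_gt_of_ne hne with hneg | hpos
    · left
      refine ⟨radius t x * Real.cos φ, ⟨hdisc, ?_⟩, ?_⟩
      · rwa [sheet_eq_fibre ht hx]
        rw [abs_of_neg (Real.sin_neg_of_neg_of_neg_pi_lt hneg hφ1)]; ring
      · show -Real.arccos (radius t x * Real.cos φ / radius t x) = φ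
        rw [hdiv, ← Real.cos_neg, Real.arccos_cos (by linarith) (by linarith), neg_neg]
    · right
      refine ⟨radius t x * Real.cos φ, ⟨hdisc, ?_⟩, ?_⟩
      · rwa [sheet_eq_fibre ht hx]
        rw [abs_of_pos (Real.sin_pos_of_pos_of_lt_pi hpos hlt)]; ring
      · show Real.arccos (radius t x * Real.cos φ / radius t x) = φ
        rw [hdiv, Real.arccos_cos hpos.le hφ2]

/-- The slab `|x| < 2`. -/
def slab : Set R3 := {u | |u 0| < 2}

theorem measurableSet_slab : MeasurableSet slab :=
  measurableSet_lt (measurable_pi_apply 0).abs measurable_const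

/-- Fubini for null sets in the slab `|x| < 2`. -/
theorem areaMeasure_slab_eq_zero_iff {t : ℝ} (ht : 2 < t) {S : Set R3} (hS : MeasurableSet S) :
    areaMeasure t (slab ∩ S) = 0 ↔ ∀ᵐ x : ℝ, |x| < 2 →
      volume {a : AddCircle (2 * Real.pi) | circleFibre t (x, a) ∈ S} = 0 := by
  have hm := measurableSet_slab.inter hS
  have hmeas : ∀ s, MeasurableSet (base t ∩ sheet t s ⁻¹' (slab ∩ S)) := fun s =>
    (measurableSet_base t).inter ((continuous_sheet t s).measurable hm)
  have key : ∀ x : ℝ, (|x| < 2 → volume {a : AddCircle (2 * Real.pi) | circleFibre t (x, a) ∈ S} = 0)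
      ↔ volume (Prod.mk x ⁻¹' (base t ∩ sheet t 1 ⁻¹' (slab ∩ S))) = 0 ∧
        volume (Prod.mk x ⁻¹' (base t ∩ sheet t (-1) ⁻¹' (slab ∩ S))) = 0 := by
    intro x
    by_cases hx : |x| < 2
    · have h : ∀ s, Prod.mk x ⁻¹' (base t ∩ sheet t s ⁻¹' (slab ∩ S)) =
          {y | 0 < disc t (x, y) ∧ sheet t s (x, y) ∈ S} := by
        intro s
        ext y
        exact ⟨fun h => ⟨h.1, h.2.2⟩, fun h => ⟨h.1, hx, h.2⟩⟩
      rw [h, h, ← volume_fibre_eq_zero_iff ht hx hS]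
      exact ⟨fun h => h hx, fun h _ => h⟩
    · have h : ∀ s, Prod.mk x ⁻¹' (base t ∩ sheet t s ⁻¹' (slab ∩ S)) = ∅ := by
        intro s
        ext y
        exact ⟨fun h => hx h.2.1, False.elim⟩
      rw [h, h]
      simp [hx]
  rw [areaMeasure_eq_zero_iff hm, Measure.volume_eq_prod, Measure.measure_prod_null (hmeas 1),
    Measure.measure_prod_null (hmeas (-1))]
  simp only [key]
  exact eventually_and.symm

/-! ### Ergodicity on the elliptic part -/

/-- The Vieta involution `(x, y, z) ↦ (x, y, xy - z)`. -/
def vieta : Gam :=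
  ⟨⟨fun u => ![u 0, u 1, u 0 * u 1 - u 2], fun u => ![u 0, u 1, u 0 * u 1 - u 2],
      fun u => by ext i; fin_cases i <;> simp, fun u => by ext i; fin_cases i <;> simp⟩,
    ⟨![.X 0, .X 1, .X 0 * .X 1 - .X 2], fun u i => by fin_cases i <;> simp⟩,
    ⟨![.X 0, .X 1, .X 0 * .X 1 - .X 2], fun u i => by fin_cases i <;> simp⟩,
    fun u => by simp [kappa]; ring⟩

theorem vieta_smul (u : R3) : vieta • u = ![u 0, u 1, u 0 * u 1 - u 2] := rfl

/-- A Dehn twist, `(x, y, z) ↦ (x, xy - z, y)`. -/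
def twist : Gam := permGam (Equiv.swap 1 2) * vieta

theorem twist_smul (u : R3) : twist • u = ![u 0, u 0 * u 1 - u 2, u 1] := by
  rw [twist, mul_smul, permGam_smul, vieta_smul]
  ext i
  fin_cases i <;> rfl

/-- The Dehn twist rotates the ellipses `x = const`. -/
theorem twist_circleFibre (t : ℝ) {x : ℝ} (hx : |x| < 2) (a : AddCircle (2 * Real.pi)) :
    twist • circleFibre t (x, a) =
      circleFibre t (x, a + -((Real.arccos (x / 2) : ℝ) : AddCircle (2 * Real.pi))) := by
  induction a using QuotientAddGroup.induction_on with
  | H φ =>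
    have hx' := abs_lt.1 hx
    have hcos : Real.cos (Real.arccos (x / 2)) = x / 2 :=
      Real.cos_arccos (by linarith) (by linarith)
    have h : ((φ : AddCircle (2 * Real.pi)) + -((Real.arccos (x / 2) : ℝ) : AddCircle (2 * Real.pi)))
        = ((φ - Real.arccos (x / 2) : ℝ) : AddCircle (2 * Real.pi)) := by
      rw [AddCircle.coe_sub, sub_eq_add_neg]
    rw [show (QuotientAddGroup.mk φ : AddCircle (2 * Real.pi)) = (φ : AddCircle (2 * Real.pi))
      from rfl, h, circleFibre_coe, circleFibre_coe, twist_smul]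
    ext i
    fin_cases i
    · rfl
    · show x * (radius t x * Real.cos φ) - radius t x * Real.cos (φ + Real.arccos (x / 2)) =
        radius t x * Real.cos (φ - Real.arccos (x / 2))
      rw [Real.cos_add, Real.cos_sub, hcos]
      ring
    · show radius t x * Real.cos φ =
        radius t x * Real.cos (φ - Real.arccos (x / 2) + Real.arccos (x / 2))
      rw [sub_add_cancel]

/-- For almost all `x` the rotation angle is an irrational multiple of `2π`. -/
theorem ae_addOrderOf_arccos : ∀ᵐ x : ℝ, |x| < 2 →
    addOrderOf (-((Real.arccos (x / 2) : ℝ) : AddCircle (2 * Real.pi))) = 0 := by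
  -- `addOrderOf = 0` means infinite order. A rotation of order `n > 0` has `n · arccos (x / 2) =
  -- 2πm`, so `x = 2 cos (2πm / n)` lies in this countable set.
  have hc : (Set.range fun q : ℤ × ℕ =>
      2 * Real.cos (q.1 * (2 * Real.pi) / q.2)).Countable := Set.countable_range _
  filter_upwards [hc.ae_notMem volume] with x hx hx2
  by_contra h
  apply hx
  rw [addOrderOf_neg] at h
  set n := addOrderOf ((Real.arccos (x / 2) : ℝ) : AddCircle (2 * Real.pi)) with hn
  have h1 := addOrderOf_nsmul_eq_zero ((Real.arccos (x / 2) : ℝ) : AddCircle (2 * Real.pi))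
  rw [← hn, ← AddCircle.coe_nsmul, AddCircle.coe_eq_zero_iff] at h1
  obtain ⟨m, hm⟩ := h1
  refine ⟨(m, n), ?_⟩
  have hn0 : (n : ℝ) ≠ 0 := Nat.cast_ne_zero.2 h
  have h2 : (m : ℝ) * (2 * Real.pi) / n = Real.arccos (x / 2) := by
    rw [div_eq_iff hn0, mul_comm _ (n : ℝ)]
    simpa using hm
  have hx' := abs_lt.1 hx2
  show 2 * Real.cos ((m : ℝ) * (2 * Real.pi) / n) = x
  rw [h2, Real.cos_arccos (by linarith) (by linarith)]
  ring

theorem measurableSet_circleFibre (t x : ℝ) {A : Set R3} (hA : MeasurableSet A) :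
    MeasurableSet {a : AddCircle (2 * Real.pi) | circleFibre t (x, a) ∈ A} :=
  ((measurable_circleFibre t).comp measurable_prodMk_left) hA

/-- An invariant set meets almost every ellipse `x = const` in a null or conull set. -/
theorem ae_fibre_null_or_conull {t : ℝ} (ht : 2 < t) {A : Set R3} (hA : MeasurableSet A)
    (hinv : ∀ γ : Gam, areaMeasure t (symmDiff ((γ • ·) ⁻¹' A) A) = 0) :
    ∀ᵐ x : ℝ, |x| < 2 →
      volume {a : AddCircle (2 * Real.pi) | circleFibre t (x, a) ∈ A} = 0 ∨
      volume {a : AddCircle (2 * Real.pi) | circleFibre t (x, a) ∈ Aᶜ} = 0 := by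
  have h1 := (areaMeasure_slab_eq_zero_iff ht ((Gam_measurable twist hA).symmDiff hA)).1
    (measure_mono_null Set.inter_subset_right (hinv twist))
  filter_upwards [h1, ae_addOrderOf_arccos] with x hx1 hx2 hx
  have herg : Ergodic (· + -((Real.arccos (x / 2) : ℝ) : AddCircle (2 * Real.pi))) volume :=
    AddCircle.ergodic_add_right.2 (hx2 hx)
  have hB := measurableSet_circleFibre t x hA
  have hae : (· + -((Real.arccos (x / 2) : ℝ) : AddCircle (2 * Real.pi))) ⁻¹'
      {a : AddCircle (2 * Real.pi) | circleFibre t (x, a) ∈ A} =ᵐ[volume]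
      {a : AddCircle (2 * Real.pi) | circleFibre t (x, a) ∈ A} := by
    rw [← measure_symmDiff_eq_zero_iff]
    refine measure_mono_null (fun a ha => ?_) (hx1 hx)
    simp only [Set.mem_symmDiff, Set.mem_preimage, Set.mem_ofPred_eq, ← twist_circleFibre t hx] at ha ⊢
    exact ha
  rcases herg.quasiErgodic.ae_empty_or_univ₀ hB.nullMeasurableSet hae with h | h
  · left
    exact ae_eq_empty.1 h
  · right
    exact ae_eq_univ.1 h

/-- The values of `x` for which the ellipse lies in `A` up to a null set. -/
def fullSlices (t : ℝ) (A : Set R3) : Set ℝ :=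
  {x | volume {a : AddCircle (2 * Real.pi) | circleFibre t (x, a) ∈ Aᶜ} = 0}

theorem measurableSet_fullSlices (t : ℝ) {A : Set R3} (hA : MeasurableSet A) :
    MeasurableSet (fullSlices t A) :=
  (measurable_measure_prodMk_left (ν := (volume : Measure (AddCircle (2 * Real.pi))))
    (measurable_circleFibre t hA.compl)) (measurableSet_singleton 0)

theorem measurableSet_coord {G : Set ℝ} (hG : MeasurableSet G) (i : Fin 3) :
    MeasurableSet {u : R3 | u i ∈ G} := measurable_pi_apply i hG

/-- Almost every ellipse is null or conull for `A`, so in the slab membership in `A` is a condition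
on `x` alone, up to a null set. -/
theorem areaMeasure_slab_symmDiff {t : ℝ} (ht : 2 < t) {A : Set R3} (hA : MeasurableSet A)
    (hinv : ∀ γ : Gam, areaMeasure t (symmDiff ((γ • ·) ⁻¹' A) A) = 0) :
    areaMeasure t (slab ∩ symmDiff A {u | u 0 ∈ fullSlices t A}) = 0 := by
  rw [areaMeasure_slab_eq_zero_iff ht
    (hA.symmDiff (measurableSet_coord (measurableSet_fullSlices t hA) 0))]
  filter_upwards [ae_fibre_null_or_conull ht hA hinv] with x h hx
  by_cases hx' : x ∈ fullSlices t A
  · refine measure_mono_null (fun a ha => ?_) hx'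
    rcases ha with ⟨-, h2⟩ | ⟨-, h2⟩
    · exact absurd hx' h2
    · exact h2
  · refine measure_mono_null (fun a ha => ?_) ((h hx).resolve_right hx')
    rcases ha with ⟨h1, -⟩ | ⟨h1, -⟩
    · exact h1
    · exact absurd h1 hx'

/-- Invariant sets are null or conull in the slab `|x| < 2`. -/
theorem slab_null_or_conull {t : ℝ} (ht : 2 < t) {A : Set R3} (hA : MeasurableSet A)
    (hinv : ∀ γ : Gam, areaMeasure t (symmDiff ((γ • ·) ⁻¹' A) A) = 0) :
    areaMeasure t (slab ∩ A) = 0 ∨ areaMeasure t (slab ∩ Aᶜ) = 0 := by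
  set G := fullSlices t A with hGdef
  have hG : MeasurableSet G := measurableSet_fullSlices t hA
  have hx := areaMeasure_slab_symmDiff ht hA hinv
  rw [← hGdef] at hx
  set σ := permGam (Equiv.swap 0 1) with hσ
  have hσ0 : ∀ u : R3, (σ • u) 0 = u 1 := fun u => rfl
  have hy := areaMeasure_preimage_eq_zero σ ht hx
  -- Swapping `x` and `y`, `A` is also described by `y ∈ G`, so the two descriptions agree almost
  -- everywhere.
  have hGG : areaMeasure t {u | |u 0| < 2 ∧ |u 1| < 2 ∧ ¬ (u 0 ∈ G ↔ u 1 ∈ G)} = 0 := by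
    refine measure_mono_null ?_ (measure_union_null hx (measure_union_null hy (hinv σ)))
    rintro u ⟨h0, h1, h⟩
    by_contra hu
    apply h
    simp only [Set.mem_union, Set.mem_inter_iff, Set.mem_symmDiff, Set.mem_preimage,
      Set.mem_ofPred_eq, hσ0, slab, h0, h1, true_and] at hu
    tauto
  have hGm : MeasurableSet {u : R3 | |u 0| < 2 ∧ |u 1| < 2 ∧ ¬ (u 0 ∈ G ↔ u 1 ∈ G)} := by
    have h0 := measurableSet_coord hG 0
    have h1 := measurableSet_coord hG 1
    refine measurableSet_slab.inter (MeasurableSet.inter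
      (measurableSet_lt (measurable_pi_apply 1).abs measurable_const) ?_)
    have heq : {u : R3 | ¬ (u 0 ∈ G ↔ u 1 ∈ G)} = symmDiff {u | u 0 ∈ G} {u | u 1 ∈ G} := by
      ext u
      simp only [Set.mem_symmDiff, Set.mem_ofPred_eq]
      tauto
    have hm := h0.symmDiff h1
    rw [← heq] at hm
    exact hm
  have hvol := ((areaMeasure_eq_zero_iff hGm).1 hGG).1
  rw [Measure.volume_eq_prod, Measure.measure_prod_null ((measurableSet_base t).inter
    ((continuous_sheet t 1).measurable hGm))] at hvol
  have hae : ∀ᵐ x : ℝ, |x| < 2 → ∀ᵐ y : ℝ, |y| < 2 → (x ∈ G ↔ y ∈ G) := by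
    filter_upwards [hvol] with x h hx2
    rw [Pi.zero_apply, measure_eq_zero_iff_ae_notMem] at h
    filter_upwards [h] with y h hy2
    by_contra hne
    refine h ⟨?_, hx2, hy2, hne⟩
    -- `x² - 4` and `y² - 4` are both negative, so the whole square `|x|, |y| < 2` lies in `base t`,
    -- and one sheet suffices.
    have h1 : 0 < 4 - x ^ 2 := by nlinarith [abs_lt.1 hx2]
    have h2 : 0 < 4 - y ^ 2 := by nlinarith [abs_lt.1 hy2]
    show 0 < (x ^ 2 - 4) * (y ^ 2 - 4) + 4 * (t - 2)
    nlinarith [mul_pos h1 h2]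
  -- A single good `x` decides whether almost every `y` in `(-2, 2)` belongs to `G`.
  obtain ⟨x, hx2, hxG⟩ : ∃ x : ℝ, |x| < 2 ∧ ∀ᵐ y : ℝ, |y| < 2 → (x ∈ G ↔ y ∈ G) := by
    by_contra hno
    have h1 : ∀ᵐ x : ℝ, x ∉ Set.Ioo (-2 : ℝ) 2 := by
      filter_upwards [hae] with x h hx
      have hx2 : |x| < 2 := abs_lt.2 hx
      exact hno ⟨x, hx2, h hx2⟩
    rw [← measure_eq_zero_iff_ae_notMem, Real.volume_Ioo] at h1
    norm_num at h1
  have hnull : ∀ G' : Set ℝ, MeasurableSet G' → (∀ᵐ y : ℝ, |y| < 2 → y ∉ G') →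
      areaMeasure t (slab ∩ {u | u 0 ∈ G'}) = 0 := by
    intro G' hG' h
    rw [areaMeasure_slab_eq_zero_iff ht (measurableSet_coord hG' 0)]
    filter_upwards [h] with y h hy2
    convert measure_empty (μ := (volume : Measure (AddCircle (2 * Real.pi))))
    ext a
    exact ⟨fun ha => h hy2 ha, False.elim⟩
  by_cases hxG' : x ∈ G
  · right
    have h1 := hnull Gᶜ hG.compl (by
      filter_upwards [hxG] with y h hy2 hyG using hyG ((h hy2).1 hxG'))
    refine measure_mono_null ?_ (measure_union_null hx h1)
    rintro u ⟨hu, hA⟩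
    by_cases h : u 0 ∈ G
    · exact Or.inl ⟨hu, Or.inr ⟨h, hA⟩⟩
    · exact Or.inr ⟨hu, h⟩
  · left
    have h1 := hnull G hG (by
      filter_upwards [hxG] with y h hy2 hyG using hxG' ((h hy2).2 hyG))
    refine measure_mono_null ?_ (measure_union_null hx h1)
    rintro u ⟨hu, hA⟩
    by_cases h : u 0 ∈ G
    · exact Or.inr ⟨hu, h⟩
    · exact Or.inl ⟨hu, Or.inl ⟨hA, h⟩⟩

/-! ### Trace reduction -/

/-- The sign change fixing the `k`-th coordinate and reversing the other two. -/
def signGam (k : Fin 3) : Gam :=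
  ⟨⟨fun u i => if i = k then u i else -u i, fun u i => if i = k then u i else -u i,
      fun u => by ext i; by_cases h : i = k <;> simp [h],
      fun u => by ext i; by_cases h : i = k <;> simp [h]⟩,
    ⟨fun i => if i = k then .X i else -.X i, fun u i => by by_cases h : i = k <;> simp [h]⟩,
    ⟨fun i => if i = k then .X i else -.X i, fun u i => by by_cases h : i = k <;> simp [h]⟩,
    fun u => by fin_cases k <;> simp [kappa]⟩

theorem signGam_smul (k : Fin 3) (u : R3) :
    signGam k • u = fun i => if i = k then u i else -u i := rfl

/-- The generators of `Γ` used in the trace reduction. -/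
def generator : Equiv.Perm (Fin 3) ⊕ Fin 3 ⊕ Unit → Gam :=
  Sum.elim permGam (Sum.elim signGam fun _ => vieta)

/-- The element of `Γ` spelled by a word in the generators. -/
def word (l : List (Equiv.Perm (Fin 3) ⊕ Fin 3 ⊕ Unit)) : Gam := (l.map generator).prod

/-- Some word in the generators moves `u` into the slab `|x| ≤ 2`. -/
def ReachesSlab (u : R3) : Prop := ∃ l, |(word l • u) 0| ≤ 2

theorem ReachesSlab.of_generator {u : R3} (a : Equiv.Perm (Fin 3) ⊕ Fin 3 ⊕ Unit)
    (h : ReachesSlab (generator a • u)) : ReachesSlab u := by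
  obtain ⟨l, hl⟩ := h
  -- The last letter of a word acts first.
  refine ⟨l ++ [a], ?_⟩
  rwa [word, List.map_append, List.prod_append, List.map_singleton, List.prod_singleton, mul_smul]

theorem reachesSlab_of_abs_le {u : R3} (i : Fin 3) (h : |u i| ≤ 2) : ReachesSlab u := by
  refine ReachesSlab.of_generator (Sum.inl (Equiv.swap 0 i)) ⟨[], ?_⟩
  show |((1 : Gam) • (permGam (Equiv.swap 0 i) • u)) 0| ≤ 2
  rw [one_smul, permGam_smul, Function.comp_apply, Equiv.swap_apply_left]
  exact h

theorem mem_Omega_smul_iff (γ : Gam) (u : R3) : γ • u ∈ Omega ↔ u ∈ Omega := by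
  constructor
  · rintro ⟨δ, v, hv, h⟩
    exact ⟨γ⁻¹ * δ, v, hv, by rw [mul_smul, h, inv_smul_smul]⟩
  · rintro ⟨δ, v, hv, rfl⟩
    exact ⟨γ * δ, v, hv, mul_smul _ _ _⟩

theorem Omega0_subset_Omega : Omega0 ⊆ Omega := fun u hu => ⟨1, u, hu, one_smul _ _⟩

/-- If `z ≤ xy / 2`, then `y ≤ z` lie where `κ(x, y, ·)` decreases, so `t ≤ κ(x, y, y) ≤ κ(x, x, x)
= 2 - (x - 2)²(x + 1) ≤ 2`. -/
theorem two_mul_gt_of_max {t x y z : ℝ} (ht : 2 < t) (hx : 2 < x) (hxy : x ≤ y) (hyz : y ≤ z)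
    (hk : x ^ 2 + y ^ 2 + z ^ 2 - x * y * z - 2 = t) : 0 < 2 * z - x * y := by
  by_contra! h
  have h1 : (z - y) * (z + y - x * y) ≤ 0 :=
    mul_nonpos_of_nonneg_of_nonpos (by linarith) (by linarith)
  have h2 : (x - 2) * x ^ 2 ≤ (x - 2) * y ^ 2 :=
    mul_le_mul_of_nonneg_left (by nlinarith) (by linarith)
  have h3 : 0 ≤ (x - 2) ^ 2 * (x + 1) := by positivity
  nlinarith

/-- Replacing the largest of three large traces by its conjugate under the Vieta involution
decreases it by a definite amount. -/
theorem sqrt_le_gradKappa {t : ℝ} (ht : 2 < t) {u : R3} (hk : kappa u = t) (hu : ∀ i, 2 < u i)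
    (h0 : u 0 ≤ u 2) (h1 : u 1 ≤ u 2) : √(4 * (t - 2)) ≤ 2 * u 2 - u 0 * u 1 := by
  have hpos : 0 < 2 * u 2 - u 0 * u 1 := by
    rcases le_total (u 0) (u 1) with h | h
    · exact two_mul_gt_of_max ht (hu 0) h h1 hk
    · rw [mul_comm (u 0)]
      refine two_mul_gt_of_max ht (hu 1) h h0 ?_
      rw [← hk, kappa]; ring
  -- The square of `κ_z` is `disc = (x² - 4)(y² - 4) + 4(t - 2)`, whose first term is positive.
  rw [Real.sqrt_le_left hpos.le]
  have h := disc_eq_gradKappa_sq hk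
  have h' : disc t (u 0, u 1) = (2 * u 2 - u 0 * u 1) ^ 2 := h
  rw [← h']
  have ha : 0 < u 0 ^ 2 - 4 := by nlinarith [hu 0]
  have hb : 0 < u 1 ^ 2 - 4 := by nlinarith [hu 1]
  simp only [disc]
  nlinarith [mul_pos ha hb]

/-- Descent on the sum of the traces, measured in units of `√(4(t - 2))`: once the largest is in
third place, the Vieta involution lowers the sum by at least one unit. -/
theorem reachesSlab_of_pos {t : ℝ} (ht : 2 < t) (n : ℕ) : ∀ u : R3, kappa u = t → u ∉ Omega →
    (∀ i, 2 < u i) → u 0 + u 1 + u 2 ≤ n * √(4 * (t - 2)) → ReachesSlab u := by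
  induction n with
  | zero =>
    intro u _ _ hu h
    rw [Nat.cast_zero, zero_mul] at h
    linarith [hu 0, hu 1, hu 2]
  | succ n ih =>
    have step : ∀ u : R3, kappa u = t → u ∉ Omega → (∀ i, 2 < u i) → u 0 ≤ u 2 → u 1 ≤ u 2 →
        u 0 + u 1 + u 2 ≤ (n + 1 : ℕ) * √(4 * (t - 2)) → ReachesSlab u := by
      intro u hk hΩ hu h0 h1 hsum
      have hgrad := sqrt_le_gradKappa ht hk hu h0 h1
      refine ReachesSlab.of_generator (Sum.inr (Sum.inr ())) ?_
      show ReachesSlab (vieta • u)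
      have hk' : kappa (vieta • u) = t := (Gam_kappa _ _).trans hk
      have hΩ' : vieta • u ∉ Omega := (mem_Omega_smul_iff _ _).not.2 hΩ
      have e0 : (vieta • u) 0 = u 0 := rfl
      have e1 : (vieta • u) 1 = u 1 := rfl
      have e2 : (vieta • u) 2 = u 0 * u 1 - u 2 := rfl
      set v := vieta • u
      by_cases hz : |v 2| ≤ 2
      · exact reachesSlab_of_abs_le 2 hz
      rw [not_le, lt_abs] at hz
      rcases hz with hz | hz
      · refine ih v hk' hΩ' (fun i => ?_) ?_
        · fin_cases i
          · exact (hu 0).trans_eq e0.symm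
          · exact (hu 1).trans_eq e1.symm
          · exact hz
        · push_cast at hsum
          rw [e0, e1, e2]
          linarith
      -- The new third trace is below `-2` and the others exceed `2`; reversing those two lands in
      -- `Ω₀`, which is excluded.
      · refine absurd (Omega0_subset_Omega fun i => ?_) ((mem_Omega_smul_iff (signGam 2) v).not.2 hΩ')
        have := hu 0
        have := hu 1
        rw [signGam_smul]
        fin_cases i <;> simp <;> linarith
    intro u hk hΩ hu hsum
    obtain ⟨i, hi⟩ := Finite.exists_max u
    refine ReachesSlab.of_generator (Sum.inl (Equiv.swap i 2)) ?_
    show ReachesSlab (permGam (Equiv.swap i 2) • u)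
    have hmax : ∀ j, (permGam (Equiv.swap i 2) • u) j ≤ (permGam (Equiv.swap i 2) • u) 2 := by
      intro j
      rw [permGam_smul, Function.comp_apply, Function.comp_apply, Equiv.swap_apply_right]
      exact hi _
    refine step _ ((Gam_kappa _ _).trans hk) ((mem_Omega_smul_iff _ _).not.2 hΩ)
      (fun j => hu _) (hmax 0) (hmax 1) (le_trans (le_of_eq ?_) hsum)
    have := Equiv.sum_comp (Equiv.swap i 2) u
    rw [Fin.sum_univ_three, Fin.sum_univ_three] at this
    exact this

/-- The trace reduction: every point of `κ⁻¹(t) - Ω` is moved to the slab `|x| ≤ 2`. -/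
theorem reachesSlab {t : ℝ} (ht : 2 < t) {u : R3} (hk : kappa u = t) (hΩ : u ∉ Omega) :
    ReachesSlab u := by
  by_cases hex : ∃ i, |u i| ≤ 2
  · obtain ⟨i, hi⟩ := hex
    exact reachesSlab_of_abs_le i hi
  push Not at hex
  have hpos : ∀ v : R3, kappa v = t → v ∉ Omega → (∀ i, 2 < v i) → ReachesSlab v := by
    intro v hkv hΩv hv
    have hδ : 0 < √(4 * (t - 2)) := Real.sqrt_pos.2 (by linarith)
    obtain ⟨n, hn⟩ := exists_nat_ge ((v 0 + v 1 + v 2) / √(4 * (t - 2)))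
    exact reachesSlab_of_pos ht n v hkv hΩv hv ((div_le_iff₀ hδ).1 hn)
  have hsign : ∀ k, (∀ i, 2 < (signGam k • u) i) → ReachesSlab u := fun k h =>
    ReachesSlab.of_generator (Sum.inr (Sum.inl k))
      (hpos _ ((Gam_kappa _ _).trans hk) ((mem_Omega_smul_iff _ _).not.2 hΩ) h)
  have hneg : ∀ k, (∀ i, (signGam k • u) i < -2) → ReachesSlab u := fun k h =>
    absurd (Omega0_subset_Omega h) ((mem_Omega_smul_iff _ _).not.2 hΩ)
  -- Sign changes come in pairs: an even number of negative traces reduces to all positive, an odd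
  -- number to `Ω₀`.
  rcases lt_abs.1 (hex 0) with h0 | h0 <;> rcases lt_abs.1 (hex 1) with h1 | h1 <;>
    rcases lt_abs.1 (hex 2) with h2 | h2
  · exact hpos u hk hΩ fun i => by fin_cases i <;> assumption
  · exact hneg 2 fun i => by rw [signGam_smul]; fin_cases i <;> simp <;> linarith
  · exact hneg 1 fun i => by rw [signGam_smul]; fin_cases i <;> simp <;> linarith
  · exact hsign 0 fun i => by rw [signGam_smul]; fin_cases i <;> simp <;> linarith
  · exact hneg 0 fun i => by rw [signGam_smul]; fin_cases i <;> simp <;> linarith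
  · exact hsign 1 fun i => by rw [signGam_smul]; fin_cases i <;> simp <;> linarith
  · exact hsign 2 fun i => by rw [signGam_smul]; fin_cases i <;> simp <;> linarith
  · exact absurd (Omega0_subset_Omega fun i => by fin_cases i <;> simp <;> linarith) hΩ

/-! ### The main theorem -/

/-- Trace reduction reaches only the closed slab, while the ergodic argument concerns the open one;
this is the difference. -/
theorem areaMeasure_abs_eq_two (t : ℝ) : areaMeasure t {u | |u 0| = 2} = 0 := by
  have hm : MeasurableSet {u : R3 | |u 0| = 2} :=
    measurableSet_eq_fun (measurable_pi_apply 0).abs measurable_const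
  have key : ∀ s, volume (base t ∩ sheet t s ⁻¹' {u | |u 0| = 2}) = 0 := by
    intro s
    rw [Measure.volume_eq_prod, Measure.measure_prod_null ((measurableSet_base t).inter
      ((continuous_sheet t s).measurable hm))]
    filter_upwards [(Set.toFinite {(2 : ℝ), -2}).countable.ae_notMem volume] with x hx
    rw [Pi.zero_apply]
    convert measure_empty (μ := (volume : Measure ℝ))
    ext y
    refine ⟨fun h => hx ?_, False.elim⟩
    exact eq_or_eq_neg_of_abs_eq h.2
  exact (areaMeasure_eq_zero_iff hm).2 ⟨key _, key _⟩

/-- Openness makes `Omega` measurable without knowing that `Gam` is countable. -/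
theorem isOpen_Omega : IsOpen Omega := by
  have h : Omega = ⋃ γ : Gam, (γ • ·) ⁻¹' Omega0 := by
    ext u
    rw [Set.mem_iUnion]
    constructor
    · rintro ⟨γ, v, hv, rfl⟩
      exact ⟨γ⁻¹, by rwa [Set.mem_preimage, inv_smul_smul]⟩
    · rintro ⟨γ, hγ⟩
      exact (mem_Omega_smul_iff γ u).1 (Omega0_subset_Omega hγ)
  have h0 : IsOpen Omega0 := by
    have : Omega0 = ⋂ i, {u : R3 | u i < -2} := by ext; simp [Omega0]
    rw [this]
    exact isOpen_iInter_of_finite fun i => isOpen_lt (continuous_apply i) continuous_const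
  rw [h]
  exact isOpen_iUnion fun γ => h0.preimage (Gam_continuous γ)

theorem measurableSet_levelComplement (t : ℝ) :
    MeasurableSet (levelComplement t : Set R3) :=
  (measurableSet_eq_fun continuous_kappa.measurable measurable_const).inter
    isOpen_Omega.measurableSet.compl

theorem levelMeasure_apply (t : ℝ) (s : Set (levelComplement t)) :
    levelMeasure t s = areaMeasure t (Subtype.val '' s) :=
  (MeasurableEmbedding.subtype_coe (measurableSet_levelComplement t)).comap_apply _ _

theorem image_preimage_smul (t : ℝ) (γ : Gam) (s : Set (levelComplement t)) :
    (Subtype.val '' ((γ • ·) ⁻¹' s) : Set R3) = (γ • ·) ⁻¹' (Subtype.val '' s) := by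
  ext u
  constructor
  · rintro ⟨v, hv, rfl⟩
    exact ⟨γ • v, hv, rfl⟩
  · rintro ⟨v, hv, h⟩
    refine ⟨γ⁻¹ • v, ?_, ?_⟩
    · rwa [Set.mem_preimage, smul_inv_smul]
    · show γ⁻¹ • v.1 = u
      rw [h]
      exact inv_smul_smul γ u

/-- A word carrying a point of `B` to the closed slab takes it either into `B`, hence into a null
set, or out of `B`, which invariance makes negligible. `B` need not lie in the level set, so the
lemma applies to complements in `ℝ³`. -/
theorem levelComplement_inter_null {t : ℝ} (ht : 2 < t) {B : Set R3}
    (hinv : ∀ γ : Gam, areaMeasure t (symmDiff ((γ • ·) ⁻¹' B) B) = 0)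
    (h : areaMeasure t (slab ∩ B) = 0) :
    areaMeasure t ((levelComplement t : Set R3) ∩ B) = 0 := by
  have h' : areaMeasure t ({u | |u 0| = 2} ∪ slab ∩ B) = 0 :=
    measure_union_null (areaMeasure_abs_eq_two t) h
  -- The union runs over words, of which there are countably many.
  refine measure_mono_null ?_ (measure_iUnion_null fun l => measure_union_null
    (areaMeasure_preimage_eq_zero (word l) ht h') (hinv (word l)))
  rintro u ⟨hu, hB⟩
  obtain ⟨l, hl⟩ := reachesSlab ht hu.1 hu.2
  rw [Set.mem_iUnion]
  refine ⟨l, ?_⟩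
  by_cases hlB : word l • u ∈ B
  · left
    rcases hl.eq_or_lt with h2 | h2
    · exact Or.inl h2
    · exact Or.inr ⟨h2, hlB⟩
  · exact Or.inr (Or.inr ⟨hB, hlB⟩)

end OneHoledTorus

end

theorem mainTheorem3 (t : ℝ) (ht : 2 < t) :
    ErgodicSMul OneHoledTorus.Gam (OneHoledTorus.levelComplement t)
      (OneHoledTorus.levelMeasure t) := by
  refine @ErgodicSMul.mk _ _ _ _ _ ⟨fun γ s hs => ?_⟩ fun {s} hs hinv => ?_
  · rw [OneHoledTorus.levelMeasure_apply, OneHoledTorus.levelMeasure_apply,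
      OneHoledTorus.image_preimage_smul]
    exact OneHoledTorus.areaMeasure_preimage γ ht
      ((OneHoledTorus.measurableSet_levelComplement t).subtype_image hs)
  · set A : Set OneHoledTorus.R3 := Subtype.val '' s with hAdef
    have hA : MeasurableSet A :=
      (OneHoledTorus.measurableSet_levelComplement t).subtype_image hs
    have hinvA : ∀ γ : OneHoledTorus.Gam,
        OneHoledTorus.areaMeasure t (symmDiff ((γ • ·) ⁻¹' A) A) = 0 := by
      intro γ
      rw [hAdef, ← OneHoledTorus.image_preimage_smul,
        ← Set.image_symmDiff Subtype.val_injective, ← OneHoledTorus.levelMeasure_apply]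
      exact measure_symmDiff_eq_zero_iff.2 (hinv γ)
    rw [Filter.eventuallyConst_set']
    rcases OneHoledTorus.slab_null_or_conull ht hA hinvA with h | h
    · left
      refine ae_eq_empty.2 ?_
      rw [OneHoledTorus.levelMeasure_apply]
      refine measure_mono_null ?_ (OneHoledTorus.levelComplement_inter_null ht hinvA h)
      rintro _ ⟨v, hv, rfl⟩
      exact ⟨v.2, v, hv, rfl⟩
    · right
      refine ae_eq_univ.2 ?_
      rw [OneHoledTorus.levelMeasure_apply]
      have hinvAc : ∀ γ : OneHoledTorus.Gam,
          OneHoledTorus.areaMeasure t (symmDiff ((γ • ·) ⁻¹' Aᶜ) Aᶜ) = 0 := by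
        intro γ
        rw [Set.preimage_compl, compl_symmDiff_compl]
        exact hinvA γ
      refine measure_mono_null ?_ (OneHoledTorus.levelComplement_inter_null ht hinvAc h)
      rintro _ ⟨v, hv, rfl⟩
      exact ⟨v.2, fun ⟨w, hw, h⟩ => hv (Subtype.val_injective h ▸ hw)⟩
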